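/- Let $E$ be a Grothendieck topos, presented as the category of sheaves of sets on a small site, let $A$ be a sheaf of rings in $E$ and let $K$ be a (left) $A$-module in $E$. Equip the category $A\text{-mod}$ of $A$-modules in $E$ with the following Grothendieck topology: a family $\{M_i\to M\}_{i\in I}$ is covering if for every object $U$ of the site and every finite set $\Lambda\subseteq\Gamma(U,M)$ there is a cover $\{U_j\to U\}$ such that for each $j$ there is an $i\in I$ for which every element of $\Lambda|_{U_j}$ lifts to $\Gamma(U_j,M_i)$. Let $\underline{\mathrm{Ext}}^1_A(-,K)\to A\text{-mod}$ be the category of extensions $0\to K\to M'\to M\to 0$ of $A$-modules, sent to $M$; its arrows are the commutative diagrams that are the identity on $K$. For a module $M$, an $h_K|_M$-torsor is a sheaf of sets $P$ on $A\text{-mod}/M$ with an action of $h_K|_M\colon (N\to M)\mapsto \mathrm{Hom}_A(N,K)$ that is free and transitive (for all $N\to M$ and all $s,t\in P(N\to M)$ there is a unique $k\in\mathrm{Hom}_A(N,K)$ with $k\cdot s=t$) and such that $P$ has sections locally on $M$. Let $Bh_K\to A\text{-mod}$ be the trivial gerbe: its objects are the pairs $(M,P)$ with $P$ an $h_K|_M$-torsor,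 and an arrow $(M,P)\to(N,Q)$ is a map $f\colon M\to N$ together with an $h_K|_M$-equivariant map $P\to f^*Q$. Then for every extension $0\to K\to M'\to M\to 0$ the presheaf $h_{M'|M}$ on $A\text{-mod}/M$ represented by $M'\to M$, with $h_K|_M$ acting by addition $K\times M'\to M'\times M'\to M'$, is an $h_K|_M$-torsor. Both $\underline{\mathrm{Ext}}^1_A(-,K)$ and $Bh_K$ are fibered categories over $A\text{-mod}$, and the functor $$\rho\colon \underline{\mathrm{Ext}}^1_A(-,K)\to Bh_K,\qquad (0\to K\to M'\to M\to 0)\mapsto h_{M'|M},$$ which sends a morphism of extensions to the induced map of represented sheaves, is an equivalence of fibered categories over $A\text{-mod}$ (it has a quasi-inverse over $A\text{-mod}$, with unit and counit over $A\text{-mod}$). Consequently $\underline{\mathrm{Ext}}^1_A(-,K)\to A\text{-mod}$ is a stack, and indeed a gerbe, equivalent to the trivial gerbe $Bh_K$. -/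

import Mathlib

open CategoryTheory Limits Opposite

universe v₁ u₁ v₂ u₂ v₃ u₃ u

/-! ## Fibered categories, stacks and gerbes over a site -/

section Fibered

variable {𝒮 : Type u₁} [Category.{v₁} 𝒮]

/-- A functor `F : 𝒳 → 𝒴` over `𝒮` is an equivalence over `𝒮` if it has a quasi-inverse over `𝒮`,
the unit and counit being isomorphisms of functors over `𝒮` (i.e. with vertical components). -/
def IsEquivalenceOver {𝒳 : BasedCategory.{v₂, u₂} 𝒮} {𝒴 : BasedCategory.{v₃, u₃} 𝒮}
    (F : BasedFunctor 𝒳 𝒴) : Prop :=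
  ∃ G : BasedFunctor 𝒴 𝒳,
    Nonempty (F.comp G ≅ BasedFunctor.id 𝒳) ∧ Nonempty (G.comp F ≅ BasedFunctor.id 𝒴)

/-- The fibered category `𝒮/M → 𝒮`. -/
def overFibered (M : 𝒮) : BasedCategory 𝒮 :=
  BasedCategory.ofFunctor (Over.forget M)

/-- A sieve `R` on `M`, as the fibered category `R → 𝒮` (a full subcategory of `𝒮/M`). -/
def sieveFibered {M : 𝒮} (R : Sieve M) : BasedCategory 𝒮 :=
  BasedCategory.ofFunctor
    (ObjectProperty.ι (fun f : Over M => R.arrows f.hom) ⋙ Over.forget M)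

/-- The inclusion `R → 𝒮/M`. -/
def sieveFiberedInclusion {M : 𝒮} (R : Sieve M) :
    BasedFunctor (sieveFibered R) (overFibered M) where
  toFunctor := ObjectProperty.ι (fun f : Over M => R.arrows f.hom)
  w := rfl

/-- A functor over `𝒮` sending every arrow to a cartesian arrow. If the source is `𝒮/M` or a sieve
(where all arrows are cartesian) these are the cartesian functors. -/
def sendsToCartesian (𝒴 : BasedCategory.{v₃, u₃} 𝒮) (𝒳 : BasedCategory.{v₂, u₂} 𝒮) :
    ObjectProperty (BasedFunctor 𝒴 𝒳) :=
  fun F => ∀ ⦃a b : 𝒴.obj⦄ (φ : a ⟶ b),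
    𝒳.p.IsStronglyCartesian (𝒳.p.map (F.map φ)) (F.map φ)

/-- The restriction functor `Hom_cart(𝒮/M, 𝒳) → Hom_cart(R, 𝒳)`. The target is the category of
descent data in `𝒳` relative to the sieve `R`. -/
def restrictToSieve (𝒳 : BasedCategory.{v₂, u₂} 𝒮) {M : 𝒮} (R : Sieve M) :
    (sendsToCartesian (overFibered M) 𝒳).FullSubcategory ⥤
      (sendsToCartesian (sieveFibered R) 𝒳).FullSubcategory :=
  ObjectProperty.lift _
    (ObjectProperty.ι _ ⋙
      { obj := fun F => (sieveFiberedInclusion R).comp F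
        map := fun α => BasedCategory.whiskerLeft (sieveFiberedInclusion R) α })
    (fun F _ _ φ => F.property ((sieveFiberedInclusion R).map φ))

/-- A fibered category `𝒳 → 𝒮` is a stack if for every covering sieve `R` of `M` the restriction
`Hom_cart(𝒮/M, 𝒳) → Hom_cart(R, 𝒳)` is an equivalence of categories. -/
structure IsStackOver (J : GrothendieckTopology 𝒮) (𝒳 : BasedCategory.{v₂, u₂} 𝒮) : Prop where
  isFibered : 𝒳.p.IsFibered
  descent : ∀ (M : 𝒮) (R : Sieve M), R ∈ J M → (restrictToSieve 𝒳 R).IsEquivalence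

/-- A gerbe: a stack in groupoids that locally has objects and any two objects of which (over the
same object of the base) are locally isomorphic. As all arrows are cartesian, a span `x ← z → y`
whose two arrows lie over `f` amounts to an isomorphism of the pullbacks of `x` and `y` along
`f`. -/
structure IsGerbeOver (J : GrothendieckTopology 𝒮) (𝒳 : BasedCategory.{v₂, u₂} 𝒮) : Prop
    extends IsStackOver J 𝒳 where
  isCartesian : ∀ ⦃x y : 𝒳.obj⦄ (φ : x ⟶ y), 𝒳.p.IsStronglyCartesian (𝒳.p.map φ) φ
  locally_nonempty : ∀ M : 𝒮, ∃ R ∈ J M, ∀ ⦃N : 𝒮⦄ (f : N ⟶ M), R f →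
    ∃ x : 𝒳.obj, 𝒳.p.obj x = N
  locally_connected : ∀ (M : 𝒮) (x y : 𝒳.obj), 𝒳.p.obj x = M → 𝒳.p.obj y = M →
    ∃ R ∈ J M, ∀ ⦃N : 𝒮⦄ (f : N ⟶ M), R f →
      ∃ (z : 𝒳.obj) (φ : z ⟶ x) (ψ : z ⟶ y), 𝒳.p.IsHomLift f φ ∧ 𝒳.p.IsHomLift f ψ

end Fibered

/-! ## The site of `A`-modules -/

section ModuleSite

variable {C : Type u} [SmallCategory C] {J : GrothendieckTopology C}

/-- The functor sending a sheaf of `A`-modules to its underlying presheaf of sets. -/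
noncomputable def underlyingPresheaf (A : Sheaf J RingCat.{u}) :
    SheafOfModules.{u} A ⥤ (Cᵒᵖ ⥤ Type u) :=
  (SheafOfModules.toSheaf A ⋙ sheafToPresheaf J AddCommGrpCat.{u}) ⋙
    (Functor.whiskeringRight Cᵒᵖ AddCommGrpCat.{u} (Type u)).obj (forget AddCommGrpCat.{u})

noncomputable instance (A : Sheaf J RingCat.{u}) :
    PreservesFiniteLimits (underlyingPresheaf A) :=
  comp_preservesFiniteLimits _ _

/-- The set `Γ(U, M)`. -/
abbrev Sec {A : Sheaf J RingCat.{u}} (U : C) (M : SheafOfModules.{u} A) : Type u :=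
  ((underlyingPresheaf A).obj M).obj (op U)

/-- The restriction `Γ(U, M) → Γ(V, M)` along `g : V → U`. -/
noncomputable abbrev Sec.res {A : Sheaf J RingCat.{u}} {U V : C} {M : SheafOfModules.{u} A}
    (g : V ⟶ U) (m : Sec U M) : Sec V M :=
  ((underlyingPresheaf A).obj M).map g.op m

/-- The map `Γ(U, N) → Γ(U, M)` induced by `f : N → M`. -/
noncomputable abbrev Sec.app {A : Sheaf J RingCat.{u}} {U : C} {N M : SheafOfModules.{u} A}
    (f : N ⟶ M) (n : Sec U N) : Sec U M :=
  ((underlyingPresheaf A).map f).app (op U) n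

lemma Sec.app_res {A : Sheaf J RingCat.{u}} {U V : C} {N M : SheafOfModules.{u} A}
    (f : N ⟶ M) (g : V ⟶ U) (n : Sec U N) : Sec.app f (Sec.res g n) = Sec.res g (Sec.app f n) :=
  ConcreteCategory.congr_hom (((underlyingPresheaf A).map f).naturality g.op) n

lemma Sec.app_comp {A : Sheaf J RingCat.{u}} {U : C} {N M P : SheafOfModules.{u} A}
    (f : N ⟶ M) (g : M ⟶ P) (n : Sec U N) : Sec.app (f ≫ g) n = Sec.app g (Sec.app f n) := by
  simp [Sec.app]

lemma Sec.res_comp {A : Sheaf J RingCat.{u}} {U V W : C} {M : SheafOfModules.{u} A}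
    (g : V ⟶ U) (h : W ⟶ V) (m : Sec U M) : Sec.res (h ≫ g) m = Sec.res h (Sec.res g m) := by
  simp [Sec.res]

lemma Sec.exists_pullback {A : Sheaf J RingCat.{u}} {U : C} {N M P : SheafOfModules.{u} A}
    (f : N ⟶ M) (g : P ⟶ M) (n : Sec U N) (p : Sec U P) (h : Sec.app f n = Sec.app g p) :
    ∃ x : Sec U (pullback f g), Sec.app (pullback.fst f g) x = n ∧
      Sec.app (pullback.snd f g) x = p :=
  Types.exists_of_isPullback
    (((IsPullback.of_hasPullback f g).map (underlyingPresheaf A)).map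
      ((evaluation Cᵒᵖ (Type u)).obj (op U))) n p h

/-- A sieve `S` on the `A`-module `M` lifts finite sets of sections locally: for every `U` and every
finite `Λ ⊆ Γ(U, M)` there is a cover of `U` on each member `V` of which all of `Λ|_V` lifts to
`Γ(V, N)` for a single `N → M` in `S`. -/
def LiftsFiniteSets {A : Sheaf J RingCat.{u}} {M : SheafOfModules.{u} A} (S : Sieve M) : Prop :=
  ∀ (U : C) (Λ : Set (Sec U M)), Λ.Finite →
    ∃ T ∈ J U, ∀ ⦃V : C⦄ (g : V ⟶ U), T g →
      ∃ (N : SheafOfModules.{u} A) (f : N ⟶ M), S f ∧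
        ∀ m ∈ Λ, ∃ n : Sec V N, Sec.app f n = Sec.res g m

/-- The topology on `A`-mod. A family `M_i → M` is covering iff the sieve it generates lifts
finite sets of sections locally. -/
def aModTopology (A : Sheaf J RingCat.{u}) : GrothendieckTopology (SheafOfModules.{u} A) where
  sieves M := {S | LiftsFiniteSets S}
  top_mem' M U Λ _ := ⟨⊤, J.top_mem U, fun V g _ =>
    ⟨M, 𝟙 M, trivial, fun m _ => ⟨Sec.res g m, by simp [Sec.app]⟩⟩⟩
  pullback_stable' := by
    intro M M' S h hS U Λ hΛ
    obtain ⟨T, hT, H⟩ := hS U ((fun m => Sec.app h m) '' Λ) (hΛ.image _)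
    refine ⟨T, hT, fun V g hg => ?_⟩
    obtain ⟨N, f, hf, HN⟩ := H g hg
    refine ⟨pullback f h, pullback.snd f h, ?_, fun m hm => ?_⟩
    · change S (pullback.snd f h ≫ h)
      rw [← pullback.condition]
      exact S.downward_closed hf _
    · obtain ⟨n, hn⟩ := HN _ ⟨m, hm, rfl⟩
      obtain ⟨x, -, hx⟩ := Sec.exists_pullback f h n (Sec.res g m) (by rw [hn, Sec.app_res])
      exact ⟨x, hx⟩
  transitive' := by
    intro M S hS R hR U Λ hΛ
    obtain ⟨T, hT, H⟩ := hS U Λ hΛ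
    have key : ∀ ⦃V : C⦄ (g : V ⟶ U), T g → ∃ T' ∈ J V, ∀ ⦃W : C⦄ (k : W ⟶ V), T' k →
        ∃ (N : SheafOfModules.{u} A) (f : N ⟶ M), R f ∧
          ∀ m ∈ Λ, ∃ n : Sec W N, Sec.app f n = Sec.res (k ≫ g) m := by
      intro V g hg
      obtain ⟨N, f, hf, HN⟩ := H g hg
      have : Nonempty (Sec V N) := ⟨(0 : N.val.obj (op V))⟩
      choose! n hn using HN
      obtain ⟨T', hT', H'⟩ := hR hf V (n '' Λ) (hΛ.image _)
      refine ⟨T', hT', fun W k hk => ?_⟩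
      obtain ⟨N', f', hf', HN'⟩ := H' k hk
      refine ⟨N', f' ≫ f, hf', fun m hm => ?_⟩
      obtain ⟨n', hn'⟩ := HN' _ ⟨m, hm, rfl⟩
      exact ⟨n', by rw [Sec.app_comp, hn', Sec.app_res, hn m hm, Sec.res_comp]⟩
    choose T' hT' H' using key
    refine ⟨Sieve.bind T.arrows fun _ g hg => T' g hg,
      J.bind_covering hT fun _ g hg => hT' g hg, ?_⟩
    rintro W _ ⟨V, k, g, hg, hk, rfl⟩
    exact H' g hg k hk

end ModuleSite

section Rho

variable {C : Type u} [SmallCategory C] {J : GrothendieckTopology C} {A : Sheaf J RingCat.{u}}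

/-! ## The fibered category of extensions -/

/-- An extension `0 → K → M' → M → 0` of `A`-modules, with `M` and `M'` varying and `K` fixed. -/
structure Extension (K : SheafOfModules.{u} A) where
  /-- the module `M` -/
  base : SheafOfModules.{u} A
  /-- the module `M'` -/
  total : SheafOfModules.{u} A
  /-- the inclusion `K → M'` -/
  incl : K ⟶ total
  /-- the projection `M' → M` -/
  proj : total ⟶ base
  w : incl ≫ proj = 0
  exact : (ShortComplex.mk incl proj w).ShortExact

namespace Extension

variable {K : SheafOfModules.{u} A}

/-- A morphism of extensions: a commutative diagram that is the identity on `K`. -/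
@[ext]
structure Hom (ξ η : Extension K) where
  /-- the map on `M` -/
  base : ξ.base ⟶ η.base
  /-- the map on `M'` -/
  total : ξ.total ⟶ η.total
  incl_total : ξ.incl ≫ total = η.incl
  total_proj : total ≫ η.proj = ξ.proj ≫ base

attribute [simp] Hom.incl_total Hom.total_proj

instance : Category (Extension K) where
  Hom := Hom
  id ξ := { base := 𝟙 _, total := 𝟙 _, incl_total := by simp, total_proj := by simp }
  comp f g :=
    { base := f.base ≫ g.base
      total := f.total ≫ g.total
      incl_total := by rw [← Category.assoc, f.incl_total, g.incl_total]
      total_proj := by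
        rw [Category.assoc, g.total_proj, ← Category.assoc, f.total_proj, Category.assoc] }
  id_comp _ := Hom.ext (Category.id_comp _) (Category.id_comp _)
  comp_id _ := Hom.ext (Category.comp_id _) (Category.comp_id _)
  assoc _ _ _ := Hom.ext (Category.assoc _ _ _) (Category.assoc _ _ _)

end Extension

/-- `Ext¹_A(–, K) → A-mod`, sending `0 → K → M' → M → 0` to `M`. -/
def extensionsOver (K : SheafOfModules.{u} A) : BasedCategory (SheafOfModules.{u} A) where
  obj := Extension K
  p := { obj := fun ξ => ξ.base, map := fun {ξ η} (f : Extension.Hom ξ η) => f.base }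

/-! ## Torsors under the sheaf represented by `K` -/

/-- A module `M` and a presheaf of sets on `A-mod/M` with an action of `h_K|_M`. -/
structure ActedPresheaf (K : SheafOfModules.{u} A) where
  /-- the module `M` -/
  base : SheafOfModules.{u} A
  /-- the presheaf on `A-mod/M` -/
  carrier : (Over base)ᵒᵖ ⥤ Type u
  /-- the action of `Hom_A(N, K)` on the sections over `N → M` -/
  act : ∀ X : Over base, (X.left ⟶ K) → carrier.obj (op X) → carrier.obj (op X)
  zero_act : ∀ (X : Over base) (s : carrier.obj (op X)), act X 0 s = s
  add_act : ∀ (X : Over base) (k l : X.left ⟶ K) (s : carrier.obj (op X)),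
    act X (k + l) s = act X k (act X l s)
  map_act : ∀ (X Y : Over base) (f : Y ⟶ X) (k : X.left ⟶ K) (s : carrier.obj (op X)),
    carrier.map f.op (act X k s) = act Y (f.left ≫ k) (carrier.map f.op s)

namespace ActedPresheaf

variable {K : SheafOfModules.{u} A}

/-- A morphism over `f : M → M'` is an equivariant map `P → f^* P'`, where the pullback
`f^* P'` is the restriction of `P'` along `A-mod/M → A-mod/M'`. -/
structure Hom (P Q : ActedPresheaf K) where
  /-- the map `M → M'` -/
  base : P.base ⟶ Q.base
  /-- the map `P → f^* P'` -/
  app : ∀ X : Over P.base, P.carrier.obj (op X) → Q.carrier.obj (op ((Over.map base).obj X))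
  naturality : ∀ (X Y : Over P.base) (f : Y ⟶ X) (s : P.carrier.obj (op X)),
    app Y (P.carrier.map f.op s) = Q.carrier.map ((Over.map base).map f).op (app X s)
  app_act : ∀ (X : Over P.base) (k : X.left ⟶ K) (s : P.carrier.obj (op X)),
    app X (P.act X k s) = Q.act ((Over.map base).obj X) k (app X s)

section

variable {D : Type u₁} [Category.{v₁} D] {M : D} (F : (Over M)ᵒᵖ ⥤ Type u)

/-- The arrow of `D/M` given by the identity of the object `N`, for equal maps `N → M`. -/
def overCast {N : D} {x y : N ⟶ M} (h : x = y) : Over.mk x ⟶ Over.mk y :=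
  Over.homMk (𝟙 N) (by simp [h])

lemma map_map {X Y Z : Over M} (f : Y ⟶ X) (g : Z ⟶ Y) (h : Z ⟶ X)
    (e : g.left ≫ f.left = h.left) (s : F.obj (op X)) :
    F.map g.op (F.map f.op s) = F.map h.op s := by
  obtain rfl : g ≫ f = h := Over.OverMorphism.ext e
  simp

lemma map_eq_self {X : Over M} (f : X ⟶ X) (hf : f.left = 𝟙 X.left) (s : F.obj (op X)) :
    F.map f.op s = s := by
  obtain rfl : f = 𝟙 X := Over.OverMorphism.ext hf
  simp

end

lemma Hom.ext' {P Q : ActedPresheaf K} {φ ψ : Hom P Q} (h : φ.base = ψ.base)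
    (h' : ∀ (X : Over P.base) (s : P.carrier.obj (op X)),
      Q.carrier.map (overCast (by rw [h]) :
        (Over.map ψ.base).obj X ⟶ (Over.map φ.base).obj X).op (φ.app X s) = ψ.app X s) :
    φ = ψ := by
  obtain ⟨f, a, ha, ha'⟩ := φ
  obtain ⟨g, b, hb, hb'⟩ := ψ
  obtain rfl : f = g := h
  congr
  funext X s
  exact (map_eq_self _ _ rfl _).symm.trans (h' X s)

/-- The identity morphism. -/
def Hom.id (P : ActedPresheaf K) : Hom P P where
  base := 𝟙 P.base
  app X s := P.carrier.map
    (overCast (Category.comp_id _) : (Over.map (𝟙 P.base)).obj X ⟶ X).op s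
  naturality _ _ f s :=
    (map_map P.carrier f (overCast (Category.comp_id _)) (overCast (Category.comp_id _) ≫ f)
      rfl s).trans (map_map P.carrier _ ((Over.map (𝟙 P.base)).map f) _
      ((Category.comp_id _).trans (Category.id_comp _).symm) s).symm
  app_act _ k s :=
    (P.map_act _ _ (overCast (Category.comp_id _)) k s).trans
      (congrArg (fun l => P.act _ l _) (Category.id_comp k))

/-- The composition of morphisms. -/
def Hom.comp {P Q R : ActedPresheaf K} (φ : Hom P Q) (ψ : Hom Q R) : Hom P R where
  base := φ.base ≫ ψ.base
  app X s := R.carrier.map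
    (overCast (Category.assoc _ _ _).symm : (Over.map (φ.base ≫ ψ.base)).obj X ⟶
      (Over.map ψ.base).obj ((Over.map φ.base).obj X)).op (ψ.app _ (φ.app X s))
  naturality X Y f s := by
    rw [φ.naturality, ψ.naturality]
    exact (map_map R.carrier _ (overCast (Category.assoc _ _ _).symm)
      (overCast (Category.assoc _ _ _).symm ≫ (Over.map ψ.base).map ((Over.map φ.base).map f))
      rfl _).trans (map_map R.carrier _ ((Over.map (φ.base ≫ ψ.base)).map f) _
      ((Category.comp_id _).trans (Category.id_comp _).symm) _).symm
  app_act X k s := by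
    rw [φ.app_act]
    refine (congrArg _ (ψ.app_act _ _ _)).trans ?_
    exact (R.map_act _ _ (overCast (Category.assoc _ _ _).symm) k _).trans
      (congrArg (fun l => R.act _ l _) (Category.id_comp k))

instance : Category (ActedPresheaf K) where
  Hom := Hom
  id := Hom.id
  comp := Hom.comp
  id_comp {P Q} φ := by
    refine Hom.ext' (Category.id_comp _) fun X s => ?_
    refine (congrArg _ (congrArg _ (φ.naturality _ _ (overCast (Category.comp_id _)) s))).trans ?_
    refine (congrArg _ (map_map Q.carrier _ _ (overCast (by simp [Hom.id])) (Category.comp_id _) _)).trans ?_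
    refine (map_map Q.carrier _ _ (𝟙 _) (Category.comp_id _) _).trans ?_
    exact map_eq_self _ _ rfl _
  comp_id {P Q} φ := by
    refine Hom.ext' (Category.comp_id _) fun X s => ?_
    refine (congrArg _ (map_map Q.carrier _ _ (overCast (by simp [Hom.id])) (Category.comp_id _) _)).trans ?_
    refine (map_map Q.carrier _ _ (𝟙 _) (Category.comp_id _) _).trans ?_
    exact map_eq_self _ _ rfl _
  assoc {P Q R S} φ ψ χ := by
    refine Hom.ext' (Category.assoc _ _ _) fun X s => ?_
    refine (congrArg _ (congrArg _ (χ.naturality _ _ (overCast (Category.assoc _ _ _).symm)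
      _))).trans ?_
    refine (congrArg _ (map_map S.carrier _ _ (overCast (by simp [Hom.comp])) (Category.comp_id _) _)).trans ?_
    refine (map_map S.carrier _ _ (overCast (by simp [Hom.comp])) (Category.comp_id _) _).trans ?_
    exact (map_map S.carrier _ _ (overCast (by simp [Hom.comp])) (Category.comp_id _) _).symm

/-- `P` is an `h_K|_M`-torsor: it is a sheaf on `A-mod/M`, the action of `h_K|_M` is free and
transitive, and `P` locally admits sections. -/
structure IsTorsor (P : ActedPresheaf K) : Prop where
  isSheaf : Presheaf.IsSheaf ((aModTopology A).over P.base) P.carrier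
  free_transitive : ∀ (X : Over P.base) (s t : P.carrier.obj (op X)),
    ∃! k : X.left ⟶ K, P.act X k s = t
  locally_sections : ∃ R ∈ aModTopology A P.base, ∀ ⦃N : SheafOfModules.{u} A⦄
    (f : N ⟶ P.base), R f → Nonempty (P.carrier.obj (op (Over.mk f)))

end ActedPresheaf

/-- The trivial gerbe `B h_K → A-mod` of `h_K`-torsors. -/
def torsorsOver (K : SheafOfModules.{u} A) : BasedCategory (SheafOfModules.{u} A) where
  obj := ObjectProperty.FullSubcategory (fun P : ActedPresheaf K => P.IsTorsor)
  p := ObjectProperty.ι _ ⋙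
    { obj := fun P => P.base, map := fun {P Q} (φ : ActedPresheaf.Hom P Q) => φ.base }

/-! ## The functor `ρ` -/

/-- The map `N → M'` underlying a map from `N` to `M'` over `M`. -/
def Extension.toTotal {K : SheafOfModules.{u} A} (ξ : Extension K) {X : Over ξ.base}
    (s : X ⟶ Over.mk ξ.proj) : X.left ⟶ ξ.total :=
  s.left

lemma Extension.toTotal_proj {K : SheafOfModules.{u} A} (ξ : Extension K) {X : Over ξ.base}
    (s : X ⟶ Over.mk ξ.proj) : ξ.toTotal s ≫ ξ.proj = X.hom :=
  Over.w s

/-- A map from `N` to `M'` over `M`, given by a map `N → M'`. -/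
def Extension.ofTotal {K : SheafOfModules.{u} A} (ξ : Extension K) {X : Over ξ.base}
    (t : X.left ⟶ ξ.total) (ht : t ≫ ξ.proj = X.hom) : X ⟶ Over.mk ξ.proj :=
  Over.homMk t ht

/-- The presheaf `h_{M'|M}` represented by `M' → M`, with `h_K|_M` acting on it by addition
`K × M' → M' × M' → M'`. -/
def Extension.toActedPresheaf {K : SheafOfModules.{u} A} (ξ : Extension K) :
    ActedPresheaf K where
  base := ξ.base
  carrier := yoneda.obj (Over.mk ξ.proj)
  act X k (s : X ⟶ Over.mk ξ.proj) := ξ.ofTotal (k ≫ ξ.incl + ξ.toTotal s) (by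
    rw [Preadditive.add_comp, Category.assoc, ξ.w, comp_zero, zero_add, ξ.toTotal_proj])
  zero_act X s := Over.OverMorphism.ext <| by
    change (0 : X.left ⟶ K) ≫ ξ.incl + (_ : X.left ⟶ ξ.total) = _
    rw [zero_comp, zero_add]
    rfl
  add_act X k l s := Over.OverMorphism.ext <| by
    change (k + l) ≫ ξ.incl + (_ : X.left ⟶ ξ.total) = k ≫ ξ.incl + (l ≫ ξ.incl + _)
    rw [Preadditive.add_comp, add_assoc]
  map_act X Y f k s := Over.OverMorphism.ext <| by
    change f.left ≫ (k ≫ ξ.incl + (_ : X.left ⟶ ξ.total)) = (f.left ≫ k) ≫ ξ.incl + f.left ≫ _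
    rw [Preadditive.comp_add, Category.assoc]
    rfl

/-- The morphism of presheaves induced by a morphism of extensions: it sends a map `N → M'` over
`M` to its composite with the given map from `M'`. -/
def Extension.Hom.toActedPresheaf {K : SheafOfModules.{u} A} {ξ η : Extension K}
    (f : Extension.Hom ξ η) : ActedPresheaf.Hom ξ.toActedPresheaf η.toActedPresheaf where
  base := f.base
  app (X : Over ξ.base) (s : X ⟶ Over.mk ξ.proj) :=
    η.ofTotal (X := (Over.map f.base).obj X) (ξ.toTotal s ≫ f.total) (by
      rw [Category.assoc, f.total_proj, ← Category.assoc, ξ.toTotal_proj]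
      rfl)
  naturality X Y g s := Over.OverMorphism.ext (Category.assoc _ _ _)
  app_act X k s := Over.OverMorphism.ext <| by
    change (k ≫ ξ.incl + ξ.toTotal s) ≫ f.total = k ≫ η.incl + ξ.toTotal s ≫ f.total
    rw [Preadditive.add_comp, Category.assoc, f.incl_total]

/-- The functor sending an extension to `h_{M'|M}` with its `h_K|_M`-action. -/
def rhoActed (K : SheafOfModules.{u} A) : Extension K ⥤ ActedPresheaf K where
  obj ξ := ξ.toActedPresheaf
  map f := Extension.Hom.toActedPresheaf f
  map_id ξ := ActedPresheaf.Hom.ext' rfl fun X s => Over.OverMorphism.ext <| by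
    change 𝟙 X.left ≫ (_ : X.left ⟶ ξ.total) ≫ 𝟙 _ = 𝟙 X.left ≫ _
    rw [Category.comp_id]
    rfl
  map_comp {ξ η ζ} f g := ActedPresheaf.Hom.ext' rfl fun X s => Over.OverMorphism.ext <| by
    change 𝟙 X.left ≫ (_ : X.left ⟶ ξ.total) ≫ (f.total ≫ g.total) =
      𝟙 X.left ≫ (_ ≫ f.total) ≫ g.total
    rw [Category.assoc]

/-- The functor `ρ : Ext¹_A(–, K) → B h_K`, sending `0 → K → M' → M → 0` to `h_{M'|M}`, given that
all the `h_{M'|M}` are torsors. -/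
def rho (K : SheafOfModules.{u} A) (h : ∀ ξ : Extension K, ξ.toActedPresheaf.IsTorsor) :
    BasedFunctor (extensionsOver K) (torsorsOver K) where
  toFunctor := ObjectProperty.lift _ (rhoActed K) h
  w := rfl

end Rho

-- The topology on `A`-mod is subcanonical: a map out of `M` is glued on sections from local lifts,
-- and it is additive because two sections lift locally to one and the same member of a cover. An
-- epimorphism of modules generates a covering sieve. Hence `h_{M'|M}` is a sheaf, two lifts of a
-- map to `M` differ by a unique map to `K`, and `M' → M` itself carries a section: it is a torsor.
-- By Yoneda an equivariant map of such torsors is an arrow `M' → N'`, which is linear because the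
-- arrows of the site are linear maps; so `rho` is fully faithful.
--
-- The core is that every torsor `P` on `M` comes from an extension (`TorsorOver.exists_extension`).
-- Local sections give one over each summand of some coproduct `N` with an epimorphism `q : N → M`,
-- and they must be assembled into a section `s` over `N`. For two summands, `P` locally has
-- sections over `X ⊞ X`; these can be normalised on both summands and restricted to the diagonal
-- (`exists_sec_biprod`). Infinite coproducts follow because maps to them have finite support
-- locally. On `ker q` the section `s` is the translate of the zero section by some `d : ker q → K`.
-- Pushing `ker q → N` out along `d` gives the extension `E`, and `s` descends to a section `u` over
-- `E` that makes `E` represent `P` (`existsUnique_res_eq`). The descent rests on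
-- `TorsorOver.res_add`: restriction of a section is additive up to the action of `K`.
--
-- The stack property uses the same theorem. Morphisms descend because the topology is subcanonical.
-- A descent datum on a covering sieve has a torsor of compatible sections; the extension
-- representing it restricts to the datum (`essSurj_restrictToSieve_extensionsOver`). The gerbe
-- property holds since split extensions exist, and two extensions become split on the cover where
-- both projections acquire sections.

universe w

/-! ### Sections of sheaves of modules and free modules on one section -/

section Sections

variable {C : Type u} [SmallCategory C] {J : GrothendieckTopology C} {A : Sheaf J RingCat.{u}}

lemma isSheaf_underlyingPresheaf (M : SheafOfModules.{u} A) :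
    Presieve.IsSheaf J ((underlyingPresheaf A).obj M) :=
  (isSheaf_iff_isSheaf_of_type _ _).1
    (Presheaf.isSheaf_comp_of_isSheaf J _ (forget AddCommGrpCat.{u}) M.isSheaf)

lemma Sec.eq_of_locally_eq {U : C} {M : SheafOfModules.{u} A} {T : Sieve U} (hT : T ∈ J U)
    {m m' : Sec U M} (h : ∀ ⦃V : C⦄ (g : V ⟶ U), T g → Sec.res g m = Sec.res g m') : m = m' :=
  (isSheaf_underlyingPresheaf M T hT).isSeparatedFor.ext fun V g hg => h g hg

lemma Sec.exists_glue {U : C} {M : SheafOfModules.{u} A} {T : Sieve U} (hT : T ∈ J U)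
    (y : ∀ ⦃V : C⦄ (g : V ⟶ U), T g → Sec V M)
    (hy : ∀ ⦃V W : C⦄ (g : V ⟶ U) (hg : T g) (k : W ⟶ V),
      Sec.res k (y g hg) = y (k ≫ g) (T.downward_closed hg k)) :
    ∃ m : Sec U M, ∀ ⦃V : C⦄ (g : V ⟶ U) (hg : T g), Sec.res g m = y g hg := by
  let x : Presieve.FamilyOfElements ((underlyingPresheaf A).obj M) T.arrows :=
    fun V g hg => y g hg
  have hx : x.SieveCompatible := fun _ _ g k hg => (hy g hg k).symm
  exact ⟨_, fun _ g hg => (isSheaf_underlyingPresheaf M T hT).valid_glue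
    ((Presieve.compatible_iff_sieveCompatible x).2 hx) g hg⟩

lemma SheafOfModules.hom_ext_sec {M N : SheafOfModules.{u} A} {f g : M ⟶ N}
    (h : ∀ (U : C) (m : Sec U M), Sec.app f m = Sec.app g m) : f = g := by
  ext U m
  exact h U.unop m

noncomputable instance (U : C) (M : SheafOfModules.{u} A) : AddCommGroup (Sec U M) :=
  inferInstanceAs (AddCommGroup (M.val.obj (op U)))

noncomputable instance (U : C) (M : SheafOfModules.{u} A) :
    Module (A.obj.obj (op U)) (Sec U M) :=
  inferInstanceAs (Module (A.obj.obj (op U)) (M.val.obj (op U)))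

lemma Sec.app_add {U : C} {M N : SheafOfModules.{u} A} (f : M ⟶ N) (m m' : Sec U M) :
    Sec.app f (m + m') = Sec.app f m + Sec.app f m' :=
  map_add (f.val.app (op U)).hom m m'

lemma Sec.app_zero {U : C} {M N : SheafOfModules.{u} A} (f : M ⟶ N) :
    Sec.app f (0 : Sec U M) = 0 :=
  map_zero (f.val.app (op U)).hom

lemma Sec.app_smul {U : C} {M N : SheafOfModules.{u} A} (f : M ⟶ N)
    (a : A.obj.obj (op U)) (m : Sec U M) : Sec.app f (a • m) = a • Sec.app f m :=
  map_smul (f.val.app (op U)).hom a m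

lemma Sec.res_add {U V : C} {M : SheafOfModules.{u} A} (g : V ⟶ U) (m m' : Sec U M) :
    Sec.res g (m + m') = Sec.res g m + Sec.res g m' :=
  map_add (M.val.map g.op).hom m m'

lemma Sec.res_smul {U V : C} {M : SheafOfModules.{u} A} (g : V ⟶ U)
    (a : A.obj.obj (op U)) (m : Sec U M) :
    Sec.res g (a • m) = A.obj.map g.op a • Sec.res g m :=
  M.val.map_smul g.op a m

/-- A morphism given by an additive, linear and natural family of maps on sections. -/
lemma SheafOfModules.exists_hom {M N : SheafOfModules.{u} A}
    (φ : ∀ U : C, Sec U M → Sec U N)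
    (hadd : ∀ U (m m' : Sec U M), φ U (m + m') = φ U m + φ U m')
    (hsmul : ∀ U (a : A.obj.obj (op U)) (m : Sec U M), φ U (a • m) = a • φ U m)
    (hres : ∀ (U V : C) (g : V ⟶ U) (m : Sec U M), φ V (Sec.res g m) = Sec.res g (φ U m)) :
    ∃ f : M ⟶ N, ∀ (U : C) (m : Sec U M), Sec.app f m = φ U m := by
  refine ⟨⟨PresheafOfModules.homMk
    { app := fun U => AddCommGrpCat.ofHom (AddMonoidHom.mk' (φ U.unop) (hadd U.unop))
      naturality := fun U V g => ?_ } (fun U a m => hsmul U.unop a m)⟩, fun U m => rfl⟩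
  ext m
  exact hres _ _ g.unop m

/-- The sheaf of modules freely generated by a section over `V`. -/
noncomputable def freeModule (A : Sheaf J RingCat.{u}) (V : C) : SheafOfModules.{u} A :=
  (PresheafOfModules.sheafification (𝟙 A.obj)).obj
    ((PresheafOfModules.free A.obj).obj (yoneda.obj V))

/-- Sheafification and the free module on a representable presheaf are left adjoints, so `freeModule
A V` represents `Γ(V, -)`; the universal section corresponds to the identity. -/
lemma exists_generator (A : Sheaf J RingCat.{u}) (V : C) :
    ∃ e : Sec V (freeModule A V), ∀ (M : SheafOfModules.{u} A) (m : Sec V M),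
      ∃! f : freeModule A V ⟶ M, Sec.app f e = m := by
  let adj := PresheafOfModules.sheafificationAdjunction (𝟙 A.obj)
  let Φ (M : SheafOfModules.{u} A) : (freeModule A V ⟶ M) ≃ Sec V M :=
    (adj.homEquiv ((PresheafOfModules.free A.obj).obj (yoneda.obj V)) M).trans
      PresheafOfModules.freeYonedaEquiv
  have h : ∀ (M : SheafOfModules.{u} A) (f : freeModule A V ⟶ M),
      Sec.app f (Φ _ (𝟙 (freeModule A V))) = Φ M f := fun M f =>
    (congrArg PresheafOfModules.freeYonedaEquiv
      ((congrArg (adj.homEquiv _ M) (Category.id_comp f).symm).trans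
        (adj.homEquiv_naturality_right (𝟙 (freeModule A V)) f))).symm
  exact ⟨Φ _ (𝟙 (freeModule A V)), fun M m =>
    ⟨(Φ M).symm m, (h M _).trans ((Φ M).apply_symm_apply m),
      fun f hf => (Φ M).eq_symm_apply.2 ((h M f).symm.trans hf)⟩⟩

/-- The universal section of the free module. -/
noncomputable def freeModule.gen (A : Sheaf J RingCat.{u}) (V : C) : Sec V (freeModule A V) :=
  (exists_generator A V).choose

lemma freeModule.exists_desc {V : C} {M : SheafOfModules.{u} A} (m : Sec V M) :
    ∃ f : freeModule A V ⟶ M, Sec.app f (gen A V) = m :=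
  ((exists_generator A V).choose_spec M m).exists

lemma freeModule.hom_ext {V : C} {M : SheafOfModules.{u} A} {f g : freeModule A V ⟶ M}
    (h : Sec.app f (gen A V) = Sec.app g (gen A V)) : f = g :=
  ((exists_generator A V).choose_spec M _).unique h rfl

end Sections

/-! ### Local generation, tested by morphisms -/

section Dense

variable {C : Type u} [SmallCategory C] {J : GrothendieckTopology C} {A : Sheaf J RingCat.{u}}

/-- A family of submodules, stable under restriction and of local nature, that is killed by no
nonzero morphism is everything. -/
lemma Sec.mem_of_dense {M : SheafOfModules.{u} A}
    (S : ∀ U : C, Submodule (A.obj.obj (op U)) (Sec U M))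
    (hres : ∀ ⦃U V : C⦄ (g : V ⟶ U) (m : Sec U M), m ∈ S U → Sec.res g m ∈ S V)
    (hlocal : ∀ (U : C) (m : Sec U M), ∀ T ∈ J U,
      (∀ ⦃V : C⦄ (g : V ⟶ U), T g → Sec.res g m ∈ S V) → m ∈ S U)
    (hdense : ∀ (Y : SheafOfModules.{u} A) (f : M ⟶ Y),
      (∀ (U : C), ∀ m ∈ S U, Sec.app f m = 0) → f = 0) (U : C) (m : Sec U M) : m ∈ S U := by
  let S' : M.val.Submodule := { obj := fun U => S U.unop, map := fun f x hx => hres f.unop x hx }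
  -- The test morphism is `M → (M/S)^#`, the presheaf quotient followed by sheafification. It kills
  -- `S`, so it is zero.
  let Q := cokernel S'.ι
  let π : M.val ⟶ Q := cokernel.π S'.ι
  let Y : SheafOfModules.{u} A := (PresheafOfModules.sheafification (𝟙 A.obj)).obj Q
  let η := (PresheafOfModules.sheafificationAdjunction (𝟙 A.obj)).unit.app Q
  let φ (U : C) (m : Sec U M) : Sec U Y := η.app (op U) (π.app (op U) m)
  obtain ⟨f, hf⟩ := SheafOfModules.exists_hom φ
    (fun U m m' => (congrArg _ (map_add (π.app (op U)).hom m m')).trans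
      (map_add (η.app (op U)).hom _ _))
    (fun U a m => (congrArg _ (map_smul (π.app (op U)).hom a m)).trans
      (map_smul (η.app (op U)).hom a _))
    (fun U V g m => (congrArg _ (PresheafOfModules.naturality_apply π g.op m)).trans
      (PresheafOfModules.naturality_apply η g.op _))
  have hexact : ∀ (V : C) (x : Sec V M), π.app (op V) x = 0 ↔ x ∈ S V := by
    intro V x
    constructor
    · intro hx
      let ev := PresheafOfModules.evaluation A.obj (op V)
      let c := CokernelCofork.mapIsColimit _ (cokernelIsCokernel S'.ι) ev
      have hE := ShortComplex.exact_of_g_is_cokernel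
        (ShortComplex.mk (ev.map S'.ι) (ev.map π)
          (by rw [← ev.map_comp, cokernel.condition, ev.map_zero])) c
      obtain ⟨y, rfl⟩ := (ShortComplex.moduleCat_exact_iff _).1 hE x hx
      exact y.2
    · intro hx
      exact congr($(cokernel.condition S'.ι).app (op V) ⟨x, hx⟩)
  have hf0 : f = 0 := hdense Y f fun V x hx => by
    rw [hf]
    exact (congrArg _ ((hexact V x).2 hx)).trans (map_zero (η.app (op V)).hom)
  -- On underlying additive presheaves `η` is the usual sheafification map. Thus the class of `m` in
  -- `M/S` vanishes locally, and `m` lies locally in `S`.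
  have h0 : (CategoryTheory.toSheafify J Q.presheaf).app (op U) (π.app (op U) m) =
      (CategoryTheory.toSheafify J Q.presheaf).app (op U) 0 := by
    have h1 := hf U m
    rw [hf0] at h1
    exact h1.symm.trans (map_zero (η.app (op U)).hom).symm
  refine hlocal U m _ (Presheaf.equalizerSieve_mem J (CategoryTheory.toSheafify J Q.presheaf) _ _ h0)
    fun V g hg => (hexact V _).1 ?_
  change Q.map g.op _ = Q.map g.op 0 at hg
  exact (PresheafOfModules.naturality_apply π g.op m).trans (hg.trans (map_zero (Q.map g.op).hom))

/-- If a family of submodules that is stable under restriction is killed by no nonzero morphism,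
then every section locally belongs to it. -/
lemma Sec.locally_mem_of_dense {M : SheafOfModules.{u} A}
    (S : ∀ U : C, Submodule (A.obj.obj (op U)) (Sec U M))
    (hres : ∀ ⦃U V : C⦄ (g : V ⟶ U) (m : Sec U M), m ∈ S U → Sec.res g m ∈ S V)
    (hdense : ∀ (Y : SheafOfModules.{u} A) (f : M ⟶ Y),
      (∀ (U : C), ∀ m ∈ S U, Sec.app f m = 0) → f = 0) (U : C) (m : Sec U M) :
    ∃ T ∈ J U, ∀ ⦃V : C⦄ (g : V ⟶ U), T g → Sec.res g m ∈ S V := by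
  let S' (U : C) : Submodule (A.obj.obj (op U)) (Sec U M) :=
    { carrier := {m | ∃ T ∈ J U, ∀ ⦃V : C⦄ (g : V ⟶ U), T g → Sec.res g m ∈ S V}
      zero_mem' := ⟨⊤, J.top_mem U, fun V g _ => hres g _ (S U).zero_mem⟩
      add_mem' := by
        rintro m m' ⟨T, hT, h⟩ ⟨T', hT', h'⟩
        refine ⟨T ⊓ T', J.intersection_covering hT hT', fun V g hg => ?_⟩
        rw [Sec.res_add]
        exact (S V).add_mem (h g hg.1) (h' g hg.2)
      smul_mem' := by
        rintro a m ⟨T, hT, h⟩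
        refine ⟨T, hT, fun V g hg => ?_⟩
        rw [Sec.res_smul]
        exact (S V).smul_mem _ (h g hg) }
  refine Sec.mem_of_dense S' ?_ ?_ ?_ U m
  · rintro U V g m ⟨T, hT, h⟩
    refine ⟨T.pullback g, J.pullback_stable g hT, fun W k hk => ?_⟩
    rw [← Sec.res_comp]
    exact h _ hk
  · intro U m T hT h
    choose T' hT' h' using h
    refine ⟨Sieve.bind T.arrows fun _ g hg => T' g hg,
      J.bind_covering hT fun _ g hg => hT' g hg, ?_⟩
    rintro W _ ⟨V, k, g, hg, hk, rfl⟩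
    rw [Sec.res_comp]
    exact h' g hg k hk
  · intro Y f hf
    exact hdense Y f fun U m hm => hf U m ⟨⊤, J.top_mem U, fun V g _ => hres g m hm⟩

/-- A morphism that kills the presheaf image of `f` is zero because `f` is epi, so
`Sec.locally_mem_of_dense` applies to that image. -/
lemma Sec.locally_lifts_of_epi {N M : SheafOfModules.{u} A} (f : N ⟶ M) [Epi f] {U : C}
    (m : Sec U M) : ∃ T ∈ J U, ∀ ⦃V : C⦄ (g : V ⟶ U), T g →
      ∃ n : Sec V N, Sec.app f n = Sec.res g m := by
  refine Sec.locally_mem_of_dense (fun U =>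
    { carrier := {m | ∃ n : Sec U N, Sec.app f n = m}
      zero_mem' := ⟨0, Sec.app_zero f⟩
      add_mem' := ?_
      smul_mem' := ?_ }) ?_ ?_ U m
  · rintro _ _ ⟨n, rfl⟩ ⟨n', rfl⟩
    exact ⟨_, Sec.app_add f n n'⟩
  · rintro a _ ⟨n, rfl⟩
    exact ⟨_, Sec.app_smul f a n⟩
  · rintro U V g _ ⟨n, rfl⟩
    exact ⟨_, Sec.app_res f g n⟩
  · intro Y φ h
    rw [← cancel_epi f, comp_zero]
    exact SheafOfModules.hom_ext_sec fun U n => (Sec.app_comp f φ n).trans (h U _ ⟨n, rfl⟩)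

end Dense

/-! ### Finite subsums of a coproduct -/

section FiniteSupport

variable {𝒜 : Type u₁} [Category.{v₁} 𝒜] [HasZeroMorphisms 𝒜] {ι : Type u₂} (N : ι → 𝒜)
  [HasCoproduct N]

open Classical in
/-- The projection of a coproduct onto a finite subsum. -/
noncomputable def finsetProj (F : Finset ι) : ∐ N ⟶ ∐ N :=
  Sigma.desc fun i => if i ∈ F then Sigma.ι N i else 0

variable {N}

lemma ι_finsetProj {F : Finset ι} {i : ι} (hi : i ∈ F) :
    Sigma.ι N i ≫ finsetProj N F = Sigma.ι N i := by
  simp [finsetProj, hi]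

lemma ι_finsetProj_of_notMem {F : Finset ι} {i : ι} (hi : i ∉ F) :
    Sigma.ι N i ≫ finsetProj N F = 0 := by
  simp [finsetProj, hi]

lemma finsetProj_comp {F G : Finset ι} (h : F ⊆ G) :
    finsetProj N F ≫ finsetProj N G = finsetProj N F := by
  refine Sigma.hom_ext _ _ fun i => ?_
  by_cases hi : i ∈ F
  · rw [← Category.assoc, ι_finsetProj hi, ι_finsetProj (h hi)]
  · rw [← Category.assoc, ι_finsetProj_of_notMem hi, zero_comp]

end FiniteSupport

/-! ### Local finiteness of sections of a coproduct -/

section Coproducts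

variable {C : Type u} [SmallCategory C] {J : GrothendieckTopology C} {A : Sheaf J RingCat.{u}}

/-- The sections fixed by some `finsetProj` form submodules, since supports can be united. They
contain the sections coming from each summand, so a morphism killing them is zero. -/
lemma Sec.locally_finite_support {ι : Type u} (N : ι → SheafOfModules.{u} A) {U : C}
    (m : Sec U (∐ N)) : ∃ T ∈ J U, ∀ ⦃V : C⦄ (g : V ⟶ U), T g →
      ∃ F : Finset ι, Sec.app (finsetProj N F) (Sec.res g m) = Sec.res g m := by
  classical
  refine Sec.locally_mem_of_dense (fun U =>
    { carrier := {m | ∃ F : Finset ι, Sec.app (finsetProj N F) m = m}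
      zero_mem' := ⟨∅, Sec.app_zero _⟩
      add_mem' := ?_
      smul_mem' := ?_ }) ?_ ?_ U m
  · rintro m m' ⟨F, hF⟩ ⟨F', hF'⟩
    refine ⟨F ∪ F', ?_⟩
    rw [← hF, ← hF', Sec.app_add, ← Sec.app_comp, ← Sec.app_comp,
      finsetProj_comp Finset.subset_union_left, finsetProj_comp Finset.subset_union_right]
  · rintro a m ⟨F, hF⟩
    exact ⟨F, by rw [Sec.app_smul, hF]⟩
  · rintro U V g m ⟨F, hF⟩
    exact ⟨F, by rw [Sec.app_res, hF]⟩
  · intro Y φ h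
    refine Sigma.hom_ext _ _ fun i => ?_
    rw [comp_zero]
    refine SheafOfModules.hom_ext_sec fun U n => (Sec.app_comp _ φ n).trans (h U _ ⟨{i}, ?_⟩)
    rw [← Sec.app_comp, ι_finsetProj (Finset.mem_singleton_self i)]

end Coproducts

/-! ### The site of `A`-modules: covering sieves and subcanonicity -/

/-- The properties of the topology on a category of modules that the comparison of torsors and
extensions uses. -/
structure IsFinitelyLifting {𝒜 : Type u₁} [Category.{v₁} 𝒜] [Abelian 𝒜] [HasCoproducts.{u} 𝒜]
    (T : GrothendieckTopology 𝒜) : Prop where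
  generateSingleton_mem : ∀ ⦃X Y : 𝒜⦄ (f : X ⟶ Y), Epi f → Sieve.generateSingleton f ∈ T Y
  diagonal : ∀ ⦃N₁ N₂ : 𝒜⦄ (S : Sieve (N₁ ⊞ N₂)), S ∈ T (N₁ ⊞ N₂) → ∃ R ∈ T (N₁ ⊞ N₂),
    ∀ ⦃X : 𝒜⦄ (f : X ⟶ N₁ ⊞ N₂), R f → S (biprod.map (f ≫ biprod.fst) (f ≫ biprod.snd))
  finite_support : ∀ {ι : Type u} (N : ι → 𝒜), ∃ R ∈ T (∐ N), ∀ ⦃X : 𝒜⦄ (f : X ⟶ ∐ N), R f →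
    ∃ F : Finset ι, f ≫ finsetProj N F = f
  exists_epi_desc : ∀ ⦃M : 𝒜⦄ (S : Sieve M), S ∈ T M →
    ∃ (ι : Type u) (X : ι → 𝒜) (f : ∀ i, X i ⟶ M), (∀ i, S (f i)) ∧ Epi (Sigma.desc f)

section AMod

variable {C : Type u} [SmallCategory C] {J : GrothendieckTopology C} {A : Sheaf J RingCat.{u}}

/-- All the elements of a finite set have a common local witness. -/
lemma exists_common_cover {U : C} {α : Type*} {Λ : Set α} (hΛ : Λ.Finite)
    (p : α → ∀ ⦃V : C⦄, (V ⟶ U) → Prop)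
    (h : ∀ a ∈ Λ, ∃ T ∈ J U, ∀ ⦃V : C⦄ (g : V ⟶ U), T g → p a g) :
    ∃ T ∈ J U, ∀ ⦃V : C⦄ (g : V ⟶ U), T g → ∀ a ∈ Λ, p a g := by
  induction Λ, hΛ using Set.Finite.induction_on with
  | empty => exact ⟨⊤, J.top_mem U, fun _ _ _ _ h => h.elim⟩
  | @insert a s _ _ ih =>
    obtain ⟨T, hT, H⟩ := ih fun b hb => h b (Set.mem_insert_of_mem _ hb)
    obtain ⟨T', hT', H'⟩ := h a (Set.mem_insert _ _)
    refine ⟨T ⊓ T', J.intersection_covering hT hT', fun V g hg b hb => ?_⟩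
    rcases hb with rfl | hb
    · exact H' g hg.2
    · exact H g hg.1 b hb

lemma aModTopology_generateSingleton_mem {M N : SheafOfModules.{u} A} (f : N ⟶ M) [Epi f] :
    Sieve.generateSingleton f ∈ aModTopology A M := by
  intro U Λ hΛ
  obtain ⟨T, hT, H⟩ := exists_common_cover (J := J) hΛ
    (fun m V g => ∃ n : Sec V N, Sec.app f n = Sec.res g m)
    (fun m _ => Sec.locally_lifts_of_epi f m)
  exact ⟨T, hT, fun V g hg => ⟨N, f, ⟨𝟙 N, Category.id_comp f⟩, H g hg⟩⟩

/-- For a sieve on `N₁ ⊞ N₂`, the sieve of the `f = (f₁, f₂)` such that `f₁ ⊞ f₂` belongs to it. -/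
noncomputable def diagonalSieve {𝒜 : Type u₁} [Category.{v₁} 𝒜] [Abelian 𝒜] {N₁ N₂ : 𝒜}
    (S : Sieve (N₁ ⊞ N₂)) : Sieve (N₁ ⊞ N₂) where
  arrows _ f := S (biprod.map (f ≫ biprod.fst) (f ≫ biprod.snd))
  downward_closed {X Y f} hf g := by
    have : biprod.map ((g ≫ f) ≫ biprod.fst) ((g ≫ f) ≫ biprod.snd) =
      biprod.map g g ≫ biprod.map (f ≫ biprod.fst) (f ≫ biprod.snd) := by
      ext <;> simp
    rw [this]
    exact S.downward_closed hf _

/-- Both components of every section in `Λ`, viewed in `N₁ ⊞ N₂`, form a finite set, so locally they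
all lift to a single member `N` of `S`. This turns a map `X → N₁ ⊞ N₂` into a map `X ⊞ X → N`
lifting its two components. -/
lemma diagonalSieve_mem {N₁ N₂ : SheafOfModules.{u} A} (S : Sieve (N₁ ⊞ N₂))
    (hS : S ∈ aModTopology A (N₁ ⊞ N₂)) : diagonalSieve S ∈ aModTopology A (N₁ ⊞ N₂) := by
  intro U Λ hΛ
  let p₁ : N₁ ⊞ N₂ ⟶ N₁ ⊞ N₂ := biprod.fst ≫ biprod.inl
  let p₂ : N₁ ⊞ N₂ ⟶ N₁ ⊞ N₂ := biprod.snd ≫ biprod.inr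
  obtain ⟨T, hT, H⟩ := hS U ((fun m => Sec.app p₁ m) '' Λ ∪ (fun m => Sec.app p₂ m) '' Λ)
    ((hΛ.image _).union (hΛ.image _))
  refine ⟨T, hT, fun V g hg => ?_⟩
  obtain ⟨N, p, hp, HN⟩ := H g hg
  choose d hd using fun m : Λ => freeModule.exists_desc (Sec.res g m.1)
  have h₁ : ∀ m : Λ, ∃ a : freeModule A V ⟶ N, a ≫ p = d m ≫ p₁ := fun m => by
    obtain ⟨n, hn⟩ := HN _ (Or.inl ⟨m.1, m.2, rfl⟩)
    obtain ⟨a, ha⟩ := freeModule.exists_desc n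
    refine ⟨a, freeModule.hom_ext ?_⟩
    rw [Sec.app_comp, Sec.app_comp, ha, hd, hn, Sec.app_res]
  have h₂ : ∀ m : Λ, ∃ a : freeModule A V ⟶ N, a ≫ p = d m ≫ p₂ := fun m => by
    obtain ⟨n, hn⟩ := HN _ (Or.inr ⟨m.1, m.2, rfl⟩)
    obtain ⟨a, ha⟩ := freeModule.exists_desc n
    refine ⟨a, freeModule.hom_ext ?_⟩
    rw [Sec.app_comp, Sec.app_comp, ha, hd, hn, Sec.app_res]
  choose a ha using h₁
  choose b hb using h₂
  -- One free generator per element of `Λ`: the elements then lift to `X` by construction, and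
  -- `biprod.map` of the two components factors through `p` by the chosen `a` and `b`.
  refine ⟨∐ fun _ : Λ => freeModule A V, Sigma.desc d, ?_, fun m hm =>
    ⟨Sec.app (Sigma.ι (fun _ : Λ => freeModule A V) ⟨m, hm⟩) (freeModule.gen A V), ?_⟩⟩
  · change S _
    have : biprod.map (Sigma.desc d ≫ biprod.fst) (Sigma.desc d ≫ biprod.snd) =
        biprod.desc (Sigma.desc a) (Sigma.desc b) ≫ p := by
      refine biprod.hom_ext' _ _ (Sigma.hom_ext _ _ fun m => ?_) (Sigma.hom_ext _ _ fun m => ?_)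
      · simp [ha, p₁]
      · simp [hb, p₂]
    rw [this]
    exact S.downward_closed hp _
  · rw [← Sec.app_comp, Sigma.ι_desc, hd]

lemma finite_support_aModTopology {ι : Type u} (N : ι → SheafOfModules.{u} A) :
    ∃ R ∈ aModTopology A (∐ N), ∀ ⦃X : SheafOfModules.{u} A⦄ (f : X ⟶ ∐ N), R f →
      ∃ F : Finset ι, f ≫ finsetProj N F = f := by
  classical
  refine ⟨{ arrows := fun X f => ∃ F : Finset ι, f ≫ finsetProj N F = f
            downward_closed := ?_ }, ?_, fun X f hf => hf⟩
  · rintro X Y f ⟨F, hF⟩ g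
    exact ⟨F, by rw [Category.assoc, hF]⟩
  · intro U Λ hΛ
    obtain ⟨T, hT, H⟩ := exists_common_cover (J := J) hΛ
      (fun m V g => ∃ F : Finset ι, Sec.app (finsetProj N F) (Sec.res g m) = Sec.res g m)
      (fun m _ => Sec.locally_finite_support N m)
    refine ⟨T, hT, fun V g hg => ?_⟩
    choose! F hF using H g hg
    -- The union of the supports of the elements of `Λ` is still finite; each restricted section is
    -- then its own lift.
    refine ⟨∐ N, finsetProj N (hΛ.toFinset.biUnion F), ⟨_, finsetProj_comp subset_rfl⟩,
      fun m hm => ⟨Sec.res g m, ?_⟩⟩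
    rw [← hF m hm, ← Sec.app_comp, finsetProj_comp]
    exact Finset.subset_biUnion_of_mem F (hΛ.mem_toFinset.2 hm)

lemma exists_epi_desc_of_mem_aModTopology {M : SheafOfModules.{u} A} (S : Sieve M)
    (hS : S ∈ aModTopology A M) :
    ∃ (ι : Type u) (X : ι → SheafOfModules.{u} A) (f : ∀ i, X i ⟶ M),
      (∀ i, S (f i)) ∧ Epi (Sigma.desc f) := by
  -- The members of `S` need not form a small set. Those with source some `freeModule A V` do, and
  -- every local lift to a member of `S` factors through one of them.
  refine ⟨Σ V : C, { f : freeModule A V ⟶ M // S f }, fun i => freeModule A i.1,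
    fun i => i.2.1, fun i => i.2.2, ⟨fun {Y} φ ψ h => ?_⟩⟩
  refine SheafOfModules.hom_ext_sec fun U m => ?_
  obtain ⟨T, hT, H⟩ := hS U {m} (Set.finite_singleton m)
  refine Sec.eq_of_locally_eq hT fun V g hg => ?_
  obtain ⟨N, f, hf, HN⟩ := H g hg
  obtain ⟨n, hn⟩ := HN m rfl
  obtain ⟨a, ha⟩ := freeModule.exists_desc n
  have h' : (a ≫ f) ≫ φ = (a ≫ f) ≫ ψ := by
    have := congr(Sigma.ι (fun i : Σ V : C, { f : freeModule A V ⟶ M // S f } =>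
      freeModule A i.1) ⟨V, a ≫ f, S.downward_closed hf a⟩ ≫ $h)
    rwa [Sigma.ι_desc_assoc, Sigma.ι_desc_assoc] at this
  have := congr(Sec.app $h' (freeModule.gen A V))
  simpa only [Sec.app_comp, ha, hn, Sec.app_res] using this

/-- The two lifts come from one section of the fibre product, where compatibility of the family
applies. -/
lemma Sec.app_eq_of_compatible {M Y : SheafOfModules.{u} A} {S : Sieve M}
    {x : Presieve.FamilyOfElements (yoneda.obj Y) S.arrows} (hx : x.Compatible) {U : C}
    {N N' : SheafOfModules.{u} A} {f : N ⟶ M} (hf : S f) {f' : N' ⟶ M} (hf' : S f')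
    {n : Sec U N} {n' : Sec U N'} (h : Sec.app f n = Sec.app f' n') :
    Sec.app (M := Y) (x f hf) n = Sec.app (M := Y) (x f' hf') n' := by
  obtain ⟨z, rfl, rfl⟩ := Sec.exists_pullback f f' n n' h
  rw [← Sec.app_comp, ← Sec.app_comp]
  exact congr(Sec.app $(hx _ _ hf hf' pullback.condition) z)

/-- The values on sections of the morphism obtained by gluing a compatible family. -/
lemma Sec.exists_glue_hom {M Y : SheafOfModules.{u} A} {S : Sieve M} (hS : LiftsFiniteSets S)
    {x : Presieve.FamilyOfElements (yoneda.obj Y) S.arrows} (hx : x.Compatible) {U : C}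
    (m : Sec U M) : ∃ y : Sec U Y, ∀ ⦃V : C⦄ (g : V ⟶ U) ⦃N : SheafOfModules.{u} A⦄ (f : N ⟶ M)
      (hf : S f) (n : Sec V N), Sec.app f n = Sec.res g m →
        Sec.app (M := Y) (x f hf) n = Sec.res g y := by
  obtain ⟨T, hT, H⟩ := hS U {m} (Set.finite_singleton m)
  choose N f hf HN using H
  choose n hn using fun V g hg => HN (V := V) g hg m rfl
  -- The image in `Y` of a local lift does not depend on the lift, so these images glue.
  obtain ⟨y, hy⟩ := Sec.exists_glue (M := Y) hT
    (fun V g hg => Sec.app (M := Y) (x (f g hg) (hf g hg)) (n V g hg)) fun V W g hg k => by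
      rw [← Sec.app_res]
      exact Sec.app_eq_of_compatible hx _ _ (by rw [Sec.app_res, hn, hn, Sec.res_comp])
  refine ⟨y, fun V g N' f' hf' n' hn' => ?_⟩
  refine Sec.eq_of_locally_eq (J.pullback_stable g hT) fun W k hk => ?_
  have hk' : T (k ≫ g) := hk
  rw [← Sec.res_comp, hy _ hk', ← Sec.app_res]
  exact Sec.app_eq_of_compatible hx _ _ (by rw [Sec.app_res, hn, hn', Sec.res_comp])

/-- A compatible family defines a map on sections through local lifts; linearity and compatibility
with restriction are then checked on local lifts. -/
instance subcanonical_aModTopology : (aModTopology A).Subcanonical := by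
  refine GrothendieckTopology.Subcanonical.of_isSheaf_yoneda_obj _ fun Y M S hS x hx => ?_
  have hloc : ∀ {t t' : M ⟶ Y}, (∀ ⦃N : SheafOfModules.{u} A⦄ (f : N ⟶ M), S f →
      f ≫ t = f ≫ t') → t = t' := by
    intro t t' h
    refine SheafOfModules.hom_ext_sec fun U m => ?_
    obtain ⟨T, hT, H⟩ := hS U {m} (Set.finite_singleton m)
    refine Sec.eq_of_locally_eq hT fun V g hg => ?_
    obtain ⟨N, f, hf, HN⟩ := H g hg
    obtain ⟨n, hn⟩ := HN m rfl
    rw [← Sec.app_res, ← Sec.app_res, ← hn, ← Sec.app_comp, ← Sec.app_comp, h f hf]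
  choose φ hφ using fun (U : C) (m : Sec U M) => Sec.exists_glue_hom hS hx m
  obtain ⟨t, ht⟩ := SheafOfModules.exists_hom φ
    (fun U m m' => by
      -- Additivity requires `m` and `m'` to lift to the same member of the sieve: lifting single
      -- elements would not suffice here.
      obtain ⟨T, hT, H⟩ := hS U {m, m'} (Set.toFinite _)
      refine Sec.eq_of_locally_eq hT fun V g hg => ?_
      obtain ⟨N, f, hf, HN⟩ := H g hg
      obtain ⟨n, hn⟩ := HN m (by simp)
      obtain ⟨n', hn'⟩ := HN m' (by simp)
      rw [Sec.res_add, ← hφ U m g f hf n hn, ← hφ U m' g f hf n' hn', ← Sec.app_add]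
      exact (hφ U _ g f hf _ (by rw [Sec.app_add, hn, hn', Sec.res_add])).symm)
    (fun U a m => by
      obtain ⟨T, hT, H⟩ := hS U {m} (Set.toFinite _)
      refine Sec.eq_of_locally_eq hT fun V g hg => ?_
      obtain ⟨N, f, hf, HN⟩ := H g hg
      obtain ⟨n, hn⟩ := HN m (by simp)
      rw [Sec.res_smul, ← hφ U m g f hf n hn, ← Sec.app_smul]
      exact (hφ U _ g f hf _ (by rw [Sec.app_smul, hn, Sec.res_smul])).symm)
    (fun U V g m => by
      obtain ⟨T, hT, H⟩ := hS V {Sec.res g m} (Set.toFinite _)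
      refine Sec.eq_of_locally_eq hT fun W k hk => ?_
      obtain ⟨N, f, hf, HN⟩ := H k hk
      obtain ⟨n, hn⟩ := HN _ rfl
      rw [← hφ V _ k f hf n hn, ← Sec.res_comp]
      exact hφ U m (k ≫ g) f hf n (by rw [hn, Sec.res_comp]))
  have htx : x.IsAmalgamation t := fun N f hf => by
    refine SheafOfModules.hom_ext_sec fun U n => ?_
    have := hφ U (Sec.app f n) (𝟙 U) f hf n (by simp [Sec.res])
    change Sec.app (f ≫ t) n = _
    rw [Sec.app_comp, ht, this]
    simp [Sec.res]
  exact ⟨t, htx, fun t' ht' => hloc fun N f hf => (ht' f hf).trans (htx f hf).symm⟩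

lemma isFinitelyLifting_aModTopology (A : Sheaf J RingCat.{u}) :
    IsFinitelyLifting.{u, u + 1, u} (aModTopology A) where
  generateSingleton_mem _ _ f _ := aModTopology_generateSingleton_mem f
  diagonal _ _ S hS := ⟨diagonalSieve S, diagonalSieve_mem S hS, fun _ _ hf => hf⟩
  finite_support N := finite_support_aModTopology N
  exists_epi_desc _ S hS := exists_epi_desc_of_mem_aModTopology S hS

end AMod

/-! ### Torsors in an abelian category: additivity and sections over coproducts -/

/-- An `h_K|_M`-torsor for a topology on an abelian category, with sections in an arbitrary
universe: `sec x` is the set of sections over `x : X ⟶ M`. -/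
structure TorsorOver {𝒜 : Type u₁} [Category.{v₁} 𝒜] [Abelian 𝒜] (T : GrothendieckTopology 𝒜)
    (M K : 𝒜) where
  /-- the sections over `x : X ⟶ M` -/
  sec : ∀ {X : 𝒜}, (X ⟶ M) → Type w
  /-- the restriction maps -/
  res : ∀ {X Y : 𝒜} {x : X ⟶ M} {y : Y ⟶ M} (f : Y ⟶ X), f ≫ x = y → sec x → sec y
  res_id : ∀ {X : 𝒜} {x : X ⟶ M} (h : 𝟙 X ≫ x = x) (s : sec x), res (𝟙 X) h s = s
  res_res : ∀ {X Y Z : 𝒜} {x : X ⟶ M} {y : Y ⟶ M} {z : Z ⟶ M} (f : Y ⟶ X) (hf : f ≫ x = y)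
    (g : Z ⟶ Y) (hg : g ≫ y = z) (s : sec x),
    res g hg (res f hf s) = res (g ≫ f) (by rw [Category.assoc, hf, hg]) s
  /-- the action of `K` -/
  act : ∀ {X : 𝒜} {x : X ⟶ M}, (X ⟶ K) → sec x → sec x
  zero_act : ∀ {X : 𝒜} {x : X ⟶ M} (s : sec x), act 0 s = s
  add_act : ∀ {X : 𝒜} {x : X ⟶ M} (k l : X ⟶ K) (s : sec x), act (k + l) s = act k (act l s)
  res_act : ∀ {X Y : 𝒜} {x : X ⟶ M} {y : Y ⟶ M} (f : Y ⟶ X) (hf : f ≫ x = y) (k : X ⟶ K)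
    (s : sec x), res f hf (act k s) = act (f ≫ k) (res f hf s)
  free_transitive : ∀ {X : 𝒜} {x : X ⟶ M} (s t : sec x), ∃! k : X ⟶ K, act k s = t
  exists_glue : ∀ {X : 𝒜} (x : X ⟶ M) (S : Sieve X), S ∈ T X →
    ∀ s : (∀ ⦃Y : 𝒜⦄ (f : Y ⟶ X), S f → sec (f ≫ x)),
      (∀ ⦃Y Z : 𝒜⦄ (f : Y ⟶ X) (hf : S f) (g : Z ⟶ Y),
        res g (Category.assoc _ _ _).symm (s f hf) = s (g ≫ f) (S.downward_closed hf g)) →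
      ∃ t : sec x, ∀ ⦃Y : 𝒜⦄ (f : Y ⟶ X) (hf : S f), res f rfl t = s f hf
  locally_nonempty : ∃ R ∈ T M, ∀ ⦃X : 𝒜⦄ (x : X ⟶ M), R x → Nonempty (sec x)

namespace TorsorOver

variable {𝒜 : Type u₁} [Category.{v₁} 𝒜] [Abelian 𝒜] {T : GrothendieckTopology 𝒜}
  {M K : 𝒜} (P : TorsorOver.{v₁, u₁, w} T M K)

lemma res_congr {X Y : 𝒜} {x : X ⟶ M} {y : Y ⟶ M} {f g : Y ⟶ X} (e : f = g) (hf : f ≫ x = y)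
    (s : P.sec x) : P.res f hf s = P.res g (e ▸ hf) s := by
  subst e; rfl

lemma act_injective {X : 𝒜} {x : X ⟶ M} {s : P.sec x} {k l : X ⟶ K}
    (h : P.act k s = P.act l s) : k = l :=
  (P.free_transitive s _).unique rfl h.symm

/-- Two sections agree if they agree on a family that detects morphisms to `K`. -/
lemma eq_of_res_eq {X : 𝒜} {x : X ⟶ M} {s t : P.sec x} (p : ∀ ⦃Y : 𝒜⦄, (Y ⟶ X) → Prop)
    (hp : ∀ k : X ⟶ K, (∀ ⦃Y : 𝒜⦄ (f : Y ⟶ X), p f → f ≫ k = 0) → k = 0)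
    (h : ∀ ⦃Y : 𝒜⦄ (f : Y ⟶ X), p f → P.res f rfl s = P.res f rfl t) : s = t := by
  obtain ⟨k, rfl, -⟩ := P.free_transitive s t
  rw [hp k fun Y f hf => ?_, P.zero_act]
  refine P.act_injective (s := P.res f rfl s) ?_
  rw [P.zero_act, ← P.res_act, ← h f hf]

lemma eq_of_epi {X Y : 𝒜} {x : X ⟶ M} {s t : P.sec x} (f : Y ⟶ X) [Epi f]
    (h : P.res f rfl s = P.res f rfl t) : s = t := by
  obtain ⟨k, rfl, -⟩ := P.free_transitive s t
  have : f ≫ k = 0 := P.act_injective (s := P.res f rfl s) (by rw [P.zero_act, ← P.res_act, ← h])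
  rw [zero_of_epi_comp f this, P.zero_act]

/-- The difference of the two sections is a map to `K`, and maps out of a biproduct are determined
on the summands. -/
lemma eq_of_inl_inr {X Y : 𝒜} {x : X ⊞ Y ⟶ M} {s t : P.sec x}
    (h₁ : P.res biprod.inl rfl s = P.res biprod.inl rfl t)
    (h₂ : P.res biprod.inr rfl s = P.res biprod.inr rfl t) : s = t := by
  obtain ⟨k, rfl, -⟩ := P.free_transitive s t
  have e₁ : biprod.inl ≫ k = 0 :=
    P.act_injective (s := P.res biprod.inl rfl s) (by rw [P.zero_act, ← P.res_act, ← h₁])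
  have e₂ : biprod.inr ≫ k = 0 :=
    P.act_injective (s := P.res biprod.inr rfl s) (by rw [P.zero_act, ← P.res_act, ← h₂])
  rw [show k = 0 from biprod.hom_ext' _ _ (by rw [e₁, comp_zero]) (by rw [e₂, comp_zero]),
    P.zero_act]

/-- Any section can be corrected independently on the two summands, by `biprod.desc` of the two
differences. -/
lemma exists_of_inl_inr {X Y : 𝒜} {x : X ⊞ Y ⟶ M} (h : Nonempty (P.sec x))
    (a : P.sec (biprod.inl ≫ x)) (b : P.sec (biprod.inr ≫ x)) :
    ∃ s : P.sec x, P.res biprod.inl rfl s = a ∧ P.res biprod.inr rfl s = b := by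
  obtain ⟨s⟩ := h
  obtain ⟨k, rfl, -⟩ := P.free_transitive (P.res biprod.inl rfl s) a
  obtain ⟨l, rfl, -⟩ := P.free_transitive (P.res biprod.inr rfl s) b
  exact ⟨P.act (biprod.desc k l) s, by rw [P.res_act, biprod.inl_desc],
    by rw [P.res_act, biprod.inr_desc]⟩

/-- The sections of a torsor are additive in the map along which they are restricted. -/
lemma res_add {N X : 𝒜} {x : N ⟶ M} {y y₁ y₂ : X ⟶ M} (s : P.sec x) (f f' g g' : X ⟶ N)
    {k l : X ⟶ K} (hf : f ≫ x = y₁) (hf' : f' ≫ x = y₁) (hg : g ≫ x = y₂) (hg' : g' ≫ x = y₂)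
    (h₁ : P.res f hf s = P.act k (P.res f' hf' s)) (h₂ : P.res g hg s = P.act l (P.res g' hg' s))
    (h : (f + g) ≫ x = y) (h' : (f' + g') ≫ x = y) :
    P.res (f + g) h s = P.act (k + l) (P.res (f' + g') h' s) := by
  subst hf' hg'
  -- A sum of maps is `biprod.desc` restricted to the diagonal, and over `X ⊞ X` the equality can be
  -- tested on each summand.
  have key : P.res (biprod.desc f g) (x := x) (y := biprod.desc f' g' ≫ x)
      (by ext <;> simp [hf, hg]) s =
        P.act (biprod.desc k l) (P.res (biprod.desc f' g') rfl s) := by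
    refine P.eq_of_inl_inr ?_ ?_
    · rw [P.res_act, P.res_res, P.res_res, P.res_congr (biprod.inl_desc f g),
        P.res_congr (biprod.inl_desc f' g'), biprod.inl_desc k l]
      have := congrArg (P.res (𝟙 X) (y := biprod.inl ≫ biprod.desc f' g' ≫ x) (by simp)) h₁
      rwa [P.res_act, P.res_res, P.res_res, Category.id_comp k,
        P.res_congr (Category.id_comp f), P.res_congr (Category.id_comp f')] at this
    · rw [P.res_act, P.res_res, P.res_res, P.res_congr (biprod.inr_desc f g),
        P.res_congr (biprod.inr_desc f' g'), biprod.inr_desc k l]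
      have := congrArg (P.res (𝟙 X) (y := biprod.inr ≫ biprod.desc f' g' ≫ x) (by simp)) h₂
      rwa [P.res_act, P.res_res, P.res_res, Category.id_comp l,
        P.res_congr (Category.id_comp g), P.res_congr (Category.id_comp g')] at this
  have := congrArg (P.res (biprod.lift (𝟙 X) (𝟙 X)) (y := y) (by simp [← h'])) key
  rw [P.res_act, P.res_res, P.res_res] at this
  rw [P.res_congr (show f + g = biprod.lift (𝟙 X) (𝟙 X) ≫ biprod.desc f g by simp), this,
    P.res_congr (show biprod.lift (𝟙 X) (𝟙 X) ≫ biprod.desc f' g' = f' + g' by simp)]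
  simp

lemma nonempty_sec_zero (X : 𝒜) : Nonempty (P.sec (0 : X ⟶ M)) := by
  obtain ⟨R, hR, h⟩ := P.locally_nonempty
  by_cases hne : ∃ (Y : 𝒜) (f : Y ⟶ M), R f
  · obtain ⟨Y, f, hf⟩ := hne
    exact (h f hf).map (P.res (0 : X ⟶ Y) zero_comp)
  -- If the covering sieve is empty, so is its pullback to `X`, and the empty family glues.
  · push Not at hne
    obtain ⟨t, -⟩ := P.exists_glue (0 : X ⟶ M) _ (T.pullback_stable 0 hR)
      (fun Y f hf => (hne _ _ hf).elim) (fun Y Z f hf => (hne _ _ hf).elim)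
    exact ⟨t⟩

open ZeroObject in
/-- The canonical section over a zero map. -/
noncomputable def zeroSec (X : 𝒜) : P.sec (0 : X ⟶ M) :=
  P.res (0 : X ⟶ 0) comp_zero (P.nonempty_sec_zero (0 : 𝒜)).some

open ZeroObject in
-- The restriction factors through the zero object, over which the torsor has exactly one section
-- since only the zero map goes from there to `K`.
lemma res_zero {X Y : 𝒜} {y : Y ⟶ M} (h : (0 : X ⟶ Y) ≫ y = 0) (s : P.sec y) :
    P.res 0 h s = P.zeroSec X := by
  have e : (0 : X ⟶ Y) = (0 : X ⟶ (0 : 𝒜)) ≫ (0 : (0 : 𝒜) ⟶ Y) := by simp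
  rw [P.res_congr e, ← P.res_res (0 : (0 : 𝒜) ⟶ Y) zero_comp (0 : X ⟶ (0 : 𝒜)) comp_zero, zeroSec]
  congr 1
  obtain ⟨k, hk, -⟩ := P.free_transitive (P.nonempty_sec_zero (0 : 𝒜)).some
    (P.res (0 : (0 : 𝒜) ⟶ Y) zero_comp s)
  rw [← hk, show k = 0 from (isZero_zero 𝒜).eq_of_src _ _, P.zero_act]

lemma res_zeroSec {X Y : 𝒜} (f : Y ⟶ X) (h : f ≫ (0 : X ⟶ M) = 0) :
    P.res f h (P.zeroSec X) = P.zeroSec Y := by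
  rw [zeroSec, P.res_res]
  exact (P.res_congr comp_zero _ _).trans rfl

variable [HasCoproducts.{u} 𝒜] (hT : IsFinitelyLifting.{v₁, u₁, u} T)
include hT

/-- For `f` in a suitable cover, `P` has a section over `X ⊞ X → N₁ ⊞ N₂`, the sum of the components
of `f`. There is a unique one restricting to the pullbacks of `s₁` and `s₂`. Uniqueness makes these
compatible, and since the diagonal of `X` composes to `f`, their diagonal restrictions glue. -/
lemma exists_sec_biprod {N₁ N₂ : 𝒜} (x : N₁ ⊞ N₂ ⟶ M) (s₁ : P.sec (biprod.inl ≫ x))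
    (s₂ : P.sec (biprod.inr ≫ x)) : Nonempty (P.sec x) := by
  obtain ⟨R, hR, hne⟩ := P.locally_nonempty
  obtain ⟨R', hR', hdiag⟩ := hT.diagonal _ (T.pullback_stable x hR)
  let D {X : 𝒜} (f : X ⟶ N₁ ⊞ N₂) : X ⊞ X ⟶ N₁ ⊞ N₂ :=
    biprod.map (f ≫ biprod.fst) (f ≫ biprod.snd)
  have hinl {X : 𝒜} (f : X ⟶ N₁ ⊞ N₂) :
      (f ≫ biprod.fst) ≫ biprod.inl ≫ x = biprod.inl ≫ D f ≫ x := by simp [D]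
  have hinr {X : 𝒜} (f : X ⟶ N₁ ⊞ N₂) :
      (f ≫ biprod.snd) ≫ biprod.inr ≫ x = biprod.inr ≫ D f ≫ x := by simp [D]
  have hΔ {X : 𝒜} (f : X ⟶ N₁ ⊞ N₂) : biprod.lift (𝟙 X) (𝟙 X) ≫ D f = f := by ext <;> simp [D]
  have ht : ∀ ⦃X : 𝒜⦄ (f : X ⟶ N₁ ⊞ N₂), R' f → ∃ t : P.sec (D f ≫ x),
      P.res biprod.inl rfl t = P.res (f ≫ biprod.fst) (hinl f) s₁ ∧
      P.res biprod.inr rfl t = P.res (f ≫ biprod.snd) (hinr f) s₂ := fun X f hf =>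
    P.exists_of_inl_inr (hne _ (hdiag f hf)) _ _
  choose t ht₁ ht₂ using ht
  have hcomp : ∀ ⦃X Y : 𝒜⦄ (f : X ⟶ N₁ ⊞ N₂) (hf : R' f) (g : Y ⟶ X),
      P.res (biprod.map g g) (by ext <;> simp [D]) (t f hf) =
        t (g ≫ f) (R'.downward_closed hf g) := fun X Y f hf g => by
    refine P.eq_of_inl_inr ?_ ?_
    · rw [ht₁, P.res_res, P.res_congr (biprod.inl_map g g), P.res_congr (Category.assoc _ _ _),
        ← P.res_res _ (hinl f) g (by simp [D]), ← ht₁ f hf, P.res_res]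
    · rw [ht₂, P.res_res, P.res_congr (biprod.inr_map g g), P.res_congr (Category.assoc _ _ _),
        ← P.res_res _ (hinr f) g (by simp [D]), ← ht₂ f hf, P.res_res]
  obtain ⟨s, -⟩ := P.exists_glue x R' hR'
    (fun X f hf => P.res (biprod.lift (𝟙 X) (𝟙 X)) (by rw [← Category.assoc, hΔ]) (t f hf))
    (fun X Y f hf g => by
      rw [← hcomp f hf g, P.res_res, P.res_res]
      exact P.res_congr (by ext <;> simp) _ _)
  exact ⟨s⟩

omit hT in
lemma eq_of_sigma {ι : Type u} {N : ι → 𝒜} {x : ∐ N ⟶ M} {s t : P.sec x}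
    (h : ∀ i, P.res (Sigma.ι N i) rfl s = P.res (Sigma.ι N i) rfl t) : s = t := by
  obtain ⟨k, rfl, -⟩ := P.free_transitive s t
  rw [show k = 0 from Sigma.hom_ext _ _ fun i => ?_, P.zero_act]
  rw [comp_zero]
  exact P.act_injective (s := P.res (Sigma.ι N i) rfl s) (by rw [P.zero_act, ← P.res_act, ← h])

omit hT in
lemma exists_of_sigma {ι : Type u} {N : ι → 𝒜} {x : ∐ N ⟶ M} (h : Nonempty (P.sec x))
    (a : ∀ i, P.sec (Sigma.ι N i ≫ x)) :
    ∃ s : P.sec x, ∀ i, P.res (Sigma.ι N i) rfl s = a i := by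
  obtain ⟨s⟩ := h
  choose k hk _ using fun i => P.free_transitive (P.res (Sigma.ι N i) rfl s) (a i)
  exact ⟨P.act (Sigma.desc k) s, fun i => by rw [P.res_act, Sigma.ι_desc, hk]⟩

/-- Adding `j` to `F` adds the projector of the `j`-th summand to `finsetProj N F`; a section over
the sum is the diagonal restriction of one over `(∐ N) ⊞ (∐ N)`. -/
lemma nonempty_sec_finsetProj {ι : Type u} {N : ι → 𝒜} (x : ∐ N ⟶ M)
    (s : ∀ i, P.sec (Sigma.ι N i ≫ x)) (F : Finset ι) :
    Nonempty (P.sec (finsetProj N F ≫ x)) := by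
  classical
  induction F using Finset.induction_on with
  | empty =>
    exact (P.nonempty_sec_zero (∐ N)).map
      (P.res (𝟙 _) (by rw [show finsetProj N ∅ = 0 by ext; simp [finsetProj]]; simp))
  | insert j F hj ih =>
    obtain ⟨t⟩ := ih
    have e : finsetProj N (insert j F) = finsetProj N F + Sigma.π N j ≫ Sigma.ι N j := by
      refine Sigma.hom_ext _ _ fun i => ?_
      rw [Preadditive.comp_add]
      by_cases hij : i = j
      · subst hij
        rw [ι_finsetProj (Finset.mem_insert_self _ _), ι_finsetProj_of_notMem hj,
          Sigma.ι_π_eq_id_assoc, zero_add]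
      · rw [Sigma.ι_π_of_ne_assoc _ hij, zero_comp, add_zero]
        by_cases hi : i ∈ F
        · rw [ι_finsetProj hi, ι_finsetProj (Finset.mem_insert_of_mem hi)]
        · rw [ι_finsetProj_of_notMem hi, ι_finsetProj_of_notMem (by simp [hij, hi])]
    obtain ⟨r⟩ := P.exists_sec_biprod hT
      (biprod.desc (finsetProj N F ≫ x) (Sigma.π N j ≫ Sigma.ι N j ≫ x))
      (P.res (𝟙 _) (by simp) t) (P.res (Sigma.π N j) (by simp) (s j))
    exact ⟨P.res (biprod.lift (𝟙 _) (𝟙 _)) (by simp [e]) r⟩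

/-- A torsor that has sections over the summands of a coproduct has a section over it. -/
lemma nonempty_sec_sigma {ι : Type u} {N : ι → 𝒜} (x : ∐ N ⟶ M)
    (s : ∀ i, P.sec (Sigma.ι N i ≫ x)) : Nonempty (P.sec x) := by
  classical
  -- The section over `finsetProj N F ≫ x` is normalised to be `s i` on the summands in `F` and zero
  -- on the others. This makes it unique, hence compatible as `F` grows.
  have h1 : ∀ F : Finset ι, ∃ t : P.sec (finsetProj N F ≫ x), ∀ i,
      (∀ hi : i ∈ F, P.res (Sigma.ι N i) (by rw [← Category.assoc, ι_finsetProj hi]) t = s i) ∧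
      (∀ hi : i ∉ F, P.res (Sigma.ι N i) (by rw [← Category.assoc, ι_finsetProj_of_notMem hi,
        zero_comp]) t = P.zeroSec (N i)) := fun F => by
    -- Restriction along an identity transports sections between the propositionally equal maps to
    -- `M`.
    have h2 : ∀ i, ∃ a : P.sec (Sigma.ι N i ≫ finsetProj N F ≫ x),
        (∀ hi : i ∈ F, P.res (𝟙 _)
          (by rw [← Category.assoc (Sigma.ι N i), ι_finsetProj hi, Category.id_comp]) a = s i) ∧
        (∀ hi : i ∉ F, P.res (𝟙 _) (by rw [← Category.assoc (Sigma.ι N i),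
          ι_finsetProj_of_notMem hi, zero_comp, comp_zero]) a = P.zeroSec (N i)) := fun i => by
      by_cases hi : i ∈ F
      · refine ⟨P.res (𝟙 _)
          (by rw [← Category.assoc (Sigma.ι N i), ι_finsetProj hi, Category.id_comp]) (s i),
          fun _ => ?_, fun h => (h hi).elim⟩
        rw [P.res_res, P.res_congr (Category.id_comp _), P.res_id]
      · refine ⟨P.res (𝟙 _) (by rw [← Category.assoc (Sigma.ι N i),
          ι_finsetProj_of_notMem hi, zero_comp, comp_zero]) (P.zeroSec (N i)),
          fun h => (hi h).elim, fun _ => ?_⟩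
        rw [P.res_res, P.res_congr (Category.id_comp _), P.res_id]
    choose a ha using h2
    obtain ⟨t, ht⟩ := P.exists_of_sigma (P.nonempty_sec_finsetProj hT x s F) a
    refine ⟨t, fun i => ⟨fun hi => ?_, fun hi => ?_⟩⟩
    · rw [← (ha i).1 hi, ← ht, P.res_res]
      exact P.res_congr (Category.id_comp _).symm _ _
    · rw [← (ha i).2 hi, ← ht, P.res_res]
      exact P.res_congr (Category.id_comp _).symm _ _
  choose t ht using h1
  have hsub : ∀ F H : Finset ι, ∀ h : F ⊆ H,
      P.res (finsetProj N F) (by rw [← Category.assoc, finsetProj_comp h]) (t H) = t F :=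
    fun F H h => by
      refine P.eq_of_sigma fun i => ?_
      rw [P.res_res]
      by_cases hi : i ∈ F
      · have e₁ := congrArg (P.res (𝟙 _) (y := Sigma.ι N i ≫ finsetProj N F ≫ x)
          (by rw [← Category.assoc (Sigma.ι N i), ι_finsetProj hi, Category.id_comp]))
          (((ht H i).1 (h hi)).trans ((ht F i).1 hi).symm)
        rw [P.res_res, P.res_res] at e₁
        rw [P.res_congr (show Sigma.ι N i ≫ finsetProj N F = 𝟙 _ ≫ Sigma.ι N i by
          rw [ι_finsetProj hi, Category.id_comp]), e₁]
        exact P.res_congr (Category.id_comp _) _ _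
      · have e₁ := congrArg (P.res (𝟙 _) (y := Sigma.ι N i ≫ finsetProj N F ≫ x)
          (by rw [← Category.assoc (Sigma.ι N i), ι_finsetProj_of_notMem hi, zero_comp,
            comp_zero]))
          ((P.res_zero zero_comp (t H)).trans ((ht F i).2 hi).symm)
        rw [P.res_res, P.res_res] at e₁
        rw [P.res_congr (show Sigma.ι N i ≫ finsetProj N F = 𝟙 _ ≫ 0 by
          rw [ι_finsetProj_of_notMem hi, comp_zero]), e₁]
        exact P.res_congr (Category.id_comp _) _ _
  obtain ⟨R, hR, hfin⟩ := hT.finite_support N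
  choose F hF using hfin
  have hsup : ∀ {X : 𝒜} (f : X ⟶ ∐ N) (F H : Finset ι) (h : F ⊆ H) (hf : f ≫ finsetProj N F = f),
      P.res f (y := f ≫ x) (by rw [← Category.assoc, ← hf, Category.assoc f, finsetProj_comp h])
        (t H) = P.res f (by rw [← Category.assoc, hf]) (t F) := fun f F H h hf => by
    rw [← hsub F H h, P.res_res]
    exact P.res_congr hf.symm _ _
  -- On a map supported in `F`, the section is the restriction of `t F`. Two supports give the same
  -- restriction by comparison with their union.
  obtain ⟨r, -⟩ := P.exists_glue x R hR
    (fun X f hf => P.res f (by rw [← Category.assoc, hF f hf]) (t (F f hf)))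
    (fun X Y f hf g => by
      have hgf := R.downward_closed hf g
      rw [P.res_res, ← hsup (g ≫ f) (F (g ≫ f) hgf) _ Finset.subset_union_left (hF _ hgf),
        ← hsup (g ≫ f) (F f hf) (F (g ≫ f) hgf ∪ F f hf) Finset.subset_union_right
        (by rw [Category.assoc, hF])])
  exact ⟨r⟩

end TorsorOver

/-! ### Representing a torsor by an extension -/

namespace TorsorOver

variable {𝒜 : Type u₁} [Category.{v₁} 𝒜] [Abelian 𝒜] {T : GrothendieckTopology 𝒜}
  {M K : 𝒜} (P : TorsorOver.{v₁, u₁, w} T M K)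

section Universal

variable {P} {E : 𝒜} {i : K ⟶ E} {p : E ⟶ M} {w : i ≫ p = 0} {u : P.sec p}
  (hu : P.res i w u = P.act (𝟙 K) (P.zeroSec K))

include hu

/-- The hypothesis `hu` normalises `u` on `K` to the tautological translate of the zero section;
this is its restriction along `k`. -/
lemma res_comp_incl {X : 𝒜} (k : X ⟶ K) (h : (k ≫ i) ≫ p = 0) :
    P.res (k ≫ i) h u = P.act k (P.zeroSec X) := by
  rw [← P.res_res i w k comp_zero, hu, P.res_act, Category.comp_id, P.res_zeroSec]

/-- By additivity of restriction, translating a map to `E` by `K` matches the action on sections: `y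
↦ y^* u` is equivariant. -/
lemma res_incl_add {X : 𝒜} {x : X ⟶ M} (k : X ⟶ K) (y : X ⟶ E) (h : (k ≫ i + y) ≫ p = x)
    (h' : y ≫ p = x) : P.res (k ≫ i + y) h u = P.act k (P.res y h' u) := by
  have hk : (k ≫ i) ≫ p = 0 := by rw [Category.assoc, w, comp_zero]
  rw [P.res_add u (k ≫ i) 0 y y (k := k) (l := 0) hk zero_comp h' h'
    (by rw [res_comp_incl hu, P.res_zero]) (by rw [P.zero_act]) h (by rw [zero_add, h']), add_zero]
  congr 1
  exact P.res_congr (zero_add y) _ _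

/-- The extension carrying a universal section represents the torsor. -/
lemma existsUnique_res_eq (hE : (ShortComplex.mk i p w).ShortExact) {X : 𝒜} {x : X ⟶ M}
    (s : P.sec x) : ∃! y : X ⟶ E, ∃ h : y ≫ p = x, P.res y h u = s := by
  have : Mono i := hE.mono_f
  have : Epi p := hE.epi_g
  have hlift : ∀ {Y : 𝒜} (y : Y ⟶ E), y ≫ p = 0 → ∃ k : Y ⟶ K, k ≫ i = y := fun y hy =>
    ⟨hE.exact.lift y hy, hE.exact.lift_f y hy⟩
  refine existsUnique_of_exists_of_unique ?_ ?_
  -- Over `E ×_M X` both `u` and `s` are available. Correcting the first projection by their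
  -- difference `k` gives a map pulling `u` back to `s`, which has to descend along the epimorphism
  -- to `X`.
  · obtain ⟨k, hk, -⟩ := P.free_transitive
      (P.res (pullback.fst p x) pullback.condition u) (P.res (pullback.snd p x) rfl s)
    have hy' : (k ≫ i + pullback.fst p x) ≫ p = pullback.snd p x ≫ x := by
      rw [Preadditive.add_comp, Category.assoc, w, comp_zero, zero_add, pullback.condition]
    rw [← res_incl_add hu k _ hy'] at hk
    -- On the kernel the map lands in `K`, as some `c`. There `u` pulls back to the translate of
    -- zero by `c` and `s` to zero, so freeness gives `c = 0`.
    have hκ : kernel.ι (pullback.snd p x) ≫ (k ≫ i + pullback.fst p x) = 0 := by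
      obtain ⟨c, hc⟩ := hlift (kernel.ι (pullback.snd p x) ≫ (k ≫ i + pullback.fst p x))
        (by rw [Category.assoc, hy', kernel.condition_assoc, zero_comp])
      have e := congrArg (P.res (kernel.ι (pullback.snd p x)) (y := 0)
        (by rw [kernel.condition_assoc, zero_comp])) hk
      rw [P.res_res, P.res_res, P.res_congr hc.symm, P.res_congr (kernel.condition _), P.res_zero,
        res_comp_incl hu] at e
      rw [← hc, P.act_injective (e.trans (P.zero_act _).symm), zero_comp]
    have hfac := Abelian.comp_epiDesc (pullback.snd p x) _ hκ
    have hp : Abelian.epiDesc (pullback.snd p x) _ hκ ≫ p = x := by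
      rw [← cancel_epi (pullback.snd p x), ← Category.assoc, hfac, hy']
    refine ⟨_, hp, P.eq_of_epi (pullback.snd p x) ?_⟩
    rw [P.res_res, P.res_congr hfac, hk]
  · rintro y y' ⟨h, rfl⟩ ⟨h', hs⟩
    obtain ⟨k, hk⟩ := hlift (y' - y) (by rw [Preadditive.sub_comp, h, h', sub_self])
    obtain rfl : y' = k ≫ i + y := by rw [hk, sub_add_cancel]
    rw [res_incl_add hu _ _ _ h] at hs
    rw [P.act_injective (hs.trans (P.zero_act _).symm), zero_comp, zero_add]

end Universal

variable [HasCoproducts.{u} 𝒜] (hT : IsFinitelyLifting.{v₁, u₁, u} T)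
include hT

/-- A torsor has a section over the source of some epimorphism. -/
lemma exists_epi_sec : ∃ (N : 𝒜) (q : N ⟶ M), Epi q ∧ Nonempty (P.sec q) := by
  obtain ⟨R, hR, hne⟩ := P.locally_nonempty
  obtain ⟨ι, X, f, hf, hepi⟩ := hT.exists_epi_desc R hR
  exact ⟨_, _, hepi, P.nonempty_sec_sigma hT _ fun i =>
    P.res (𝟙 _) (by simp) (hne _ (hf i)).some⟩

/-- Every torsor is represented by an extension. -/
theorem exists_extension : ∃ (E : 𝒜) (i : K ⟶ E) (p : E ⟶ M) (w : i ≫ p = 0) (u : P.sec p),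
    (ShortComplex.mk i p w).ShortExact ∧ P.res i w u = P.act (𝟙 K) (P.zeroSec K) := by
  -- The map `d` records how `s` varies along the fibres of `q`. In the pushout along `d` this
  -- variation becomes translation by `K`.
  obtain ⟨N, q, hq, ⟨s⟩⟩ := P.exists_epi_sec hT
  obtain ⟨d, hd, -⟩ := P.free_transitive (P.zeroSec (kernel q))
    (P.res (kernel.ι q) (kernel.condition q) s)
  let j : N ⟶ pushout (kernel.ι q) d := pushout.inl _ _
  let i : K ⟶ pushout (kernel.ι q) d := pushout.inr _ _
  have hij : kernel.ι q ≫ j = d ≫ i := pushout.condition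
  let p : pushout (kernel.ι q) d ⟶ M := pushout.desc q 0 (by simp)
  have hjp : j ≫ p = q := pushout.inl_desc _ _ _
  have w : i ≫ p = 0 := pushout.inr_desc _ _ _
  have : Mono i := inferInstanceAs (Mono (pushout.inr _ _))
  have : Epi p := epi_of_epi_fac hjp
  have hE : (ShortComplex.mk i p w).ShortExact := by
    refine { exact := ShortComplex.exact_of_g_is_cokernel _
              (CokernelCofork.IsColimit.ofπ p w
                (fun t ht => Abelian.epiDesc q (j ≫ t) ?_) (fun t ht => ?_) fun t ht m hm => ?_) }
    · rw [← Category.assoc, hij, Category.assoc, ht, comp_zero]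
    · refine pushout.hom_ext ?_ ?_
      · change j ≫ p ≫ _ = j ≫ t
        rw [← Category.assoc, hjp, Abelian.comp_epiDesc]
      · change i ≫ p ≫ _ = i ≫ t
        rw [← Category.assoc, w, zero_comp, ht]
    · rw [← cancel_epi q, Abelian.comp_epiDesc, ← hm, reassoc_of% hjp]
  let e : N ⊞ K ⟶ pushout (kernel.ι q) d := biprod.desc j i
  have he : Epi e := ⟨fun φ ψ h => pushout.hom_ext
    (by simpa [e] using biprod.inl ≫= h) (by simpa [e] using biprod.inr ≫= h)⟩
  have hep : biprod.fst ≫ q = e ≫ p := by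
    refine biprod.hom_ext' _ _ ?_ ?_
    · simp [e, hjp]
    · simp [e, w]
  -- The section `u₀` over `N ⊞ K` is the expected pullback of `u` along the epimorphism `e`: it is
  -- `s` on `N` and the tautological translate of zero on `K`.
  let u₀ : P.sec (e ≫ p) := P.act biprod.snd (P.res biprod.fst hep s)
  -- Two maps with the same composite to `E` differ by some `z : Y → ker q`, embedded as `(ι, -d)`.
  -- By `res_add` moving along `ι` translates `s` by `z ≫ d`, and the `K`-component undoes it.
  have key : ∀ {Y : 𝒜} {y : Y ⟶ M} (g g' : Y ⟶ N ⊞ K) (hg : g ≫ e ≫ p = y)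
      (hg' : g' ≫ e ≫ p = y), g ≫ e = g' ≫ e → P.res g hg u₀ = P.res g' hg' u₀ := by
    intro Y y g g' hg hg' hgg
    let a := (g - g') ≫ biprod.fst
    let b := (g - g') ≫ biprod.snd
    have hab : a ≫ j + b ≫ i = 0 := by
      have : (g - g') ≫ e = 0 := by rw [Preadditive.sub_comp, hgg, sub_self]
      rw [← this, Category.assoc, Category.assoc, ← Preadditive.comp_add]
      congr 1
      ext <;> simp [e]
    have haq : a ≫ q = 0 := by
      have := congr($hab ≫ p)
      simpa [hjp, w] using this
    let z := kernel.lift q a haq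
    have hz : z ≫ kernel.ι q = a := kernel.lift_ι _ _ _
    have hb : z ≫ d + b = 0 := by
      rw [← cancel_mono i, zero_comp, Preadditive.add_comp, ← hab, ← hz, Category.assoc z d,
        Category.assoc z, hij]
    have h₁ : g ≫ biprod.fst = g' ≫ biprod.fst + z ≫ kernel.ι q := by simp [hz, a]
    have h₂ : g' ≫ biprod.snd = g ≫ biprod.snd + z ≫ d := by
      rw [eq_neg_of_add_eq_zero_left hb]
      simp [b]
    have hfst : (g' ≫ biprod.fst) ≫ q = y := by rw [Category.assoc, hep, hg']
    have hzq : (z ≫ kernel.ι q) ≫ q = 0 := by simp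
    have hsum : (g' ≫ biprod.fst + z ≫ kernel.ι q) ≫ q = y := by
      rw [Preadditive.add_comp, hfst, hzq, add_zero]
    have := P.res_add s (g' ≫ biprod.fst) (g' ≫ biprod.fst) (z ≫ kernel.ι q) 0
      (k := 0) (l := z ≫ d) hfst hfst hzq zero_comp (P.zero_act _).symm
      (by rw [← P.res_res _ (kernel.condition q) z comp_zero, ← hd, P.res_act, P.res_zeroSec,
        P.res_zero]) hsum (by rw [add_zero, hfst])
    rw [P.res_act, P.res_act, P.res_res, P.res_res, P.res_congr h₁, this, ← P.add_act, h₂,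
      zero_add]
    congr 1
    exact P.res_congr (add_zero _) _ _
  obtain ⟨u, hu⟩ := P.exists_glue p (Sieve.generateSingleton e) (hT.generateSingleton_mem e he)
    (fun Y f hf => P.res hf.choose (by rw [← Category.assoc, hf.choose_spec]) u₀)
    (fun Y Z f hf g => by
      rw [P.res_res]
      refine key _ _ _ _ ?_
      rw [Category.assoc, hf.choose_spec,
        ((Sieve.generateSingleton e).downward_closed hf g).choose_spec])
  refine ⟨_, i, p, w, u, hE, ?_⟩
  have hi : Sieve.generateSingleton e i := ⟨biprod.inr, biprod.inr_desc _ _⟩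
  have h₁ := congrArg (P.res (𝟙 K) (y := 0) (by rw [w, comp_zero])) (hu i hi)
  have hinr : biprod.inr ≫ e = i := biprod.inr_desc _ _
  rw [P.res_res, P.res_congr (Category.id_comp i), P.res_res] at h₁
  rw [h₁, key (𝟙 K ≫ hi.choose) biprod.inr _ (by rw [← Category.assoc, hinr, w])
    (by rw [Category.id_comp, hi.choose_spec, hinr]), P.res_act, P.res_res, biprod.inr_snd,
    P.res_congr biprod.inr_fst, P.res_zero]

end TorsorOver

/-! ### Fully faithful functors over a base -/

section Based

variable {𝒮 : Type u₁} [Category.{v₁} 𝒮] {𝒳 : BasedCategory.{v₂, u₂} 𝒮}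
  {𝒴 : BasedCategory.{v₃, u₃} 𝒮} (F : BasedFunctor 𝒳 𝒴)

/-- Every object of the target is isomorphic to one in the image by a vertical isomorphism. -/
def IsEssSurjOver : Prop :=
  ∀ y : 𝒴.obj, ∃ (x : 𝒳.obj) (e : F.obj x ≅ y), 𝒴.p.IsHomLift (𝟙 (𝒴.p.obj y)) e.hom

/-- The quasi-inverse is built from chosen preimages. Since the comparison isomorphisms are
vertical, it commutes with the projections and its unit and counit are vertical. -/
lemma isEquivalenceOver_of_fullyFaithful [F.toFunctor.Full] [F.toFunctor.Faithful]
    (hF : IsEssSurjOver F) : IsEquivalenceOver F := by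
  choose x e he using hF
  have hlift {y y' : 𝒴.obj} (φ : y ⟶ y') :
      𝒴.p.IsHomLift (𝒴.p.map φ) ((e y).hom ≫ φ ≫ (e y').inv) := by
    have : 𝒴.p.IsHomLift (𝟙 _ ≫ 𝒴.p.map φ ≫ 𝟙 _) ((e y).hom ≫ φ ≫ (e y').inv) := inferInstance
    simpa using this
  let G₀ : 𝒴.obj ⥤ 𝒳.obj :=
    { obj := x
      map := fun {y y'} φ => F.toFunctor.preimage ((e y).hom ≫ φ ≫ (e y').inv)
      map_id := fun y => F.toFunctor.map_injective (by simp)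
      map_comp := fun φ ψ => F.toFunctor.map_injective (by simp) }
  have hG₀ {y y' : 𝒴.obj} (φ : y ⟶ y') : F.map (G₀.map φ) = (e y).hom ≫ φ ≫ (e y').inv :=
    F.toFunctor.map_preimage _
  have hw {y y' : 𝒴.obj} (φ : y ⟶ y') : 𝒳.p.IsHomLift (𝒴.p.map φ) (G₀.map φ) := by
    rw [← F.isHomLift_iff, hG₀]
    exact hlift φ
  let G : BasedFunctor 𝒴 𝒳 :=
    { toFunctor := G₀
      w := CategoryTheory.Functor.ext
        (fun y => (IsHomLift.domain_eq 𝒳.p (𝒴.p.map (𝟙 y)) (G₀.map (𝟙 y)) :))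
        (fun y y' φ => IsHomLift.fac' 𝒳.p (𝒴.p.map φ) (G₀.map φ)) }
  have hnat {y y' : 𝒴.obj} (φ : y ⟶ y') :
      F.map (G₀.map φ) ≫ (e y').hom = (e y).hom ≫ φ := by
    rw [hG₀]
    simp
  have hnat' {a b : 𝒳.obj} (φ : a ⟶ b) :
      G₀.map (F.map φ) ≫ (F.toFunctor.preimageIso (e (F.obj b))).hom =
        (F.toFunctor.preimageIso (e (F.obj a))).hom ≫ φ := F.toFunctor.map_injective <| by
    rw [F.toFunctor.map_comp, F.toFunctor.map_comp, Functor.preimageIso_hom,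
      Functor.preimageIso_hom, F.toFunctor.map_preimage (e (F.obj b)).hom,
      F.toFunctor.map_preimage (e (F.obj a)).hom]
    exact hnat (F.map φ)
  refine ⟨G, ⟨BasedNatIso.mkNatIso
    (NatIso.ofComponents (fun a => F.toFunctor.preimageIso (e (F.obj a))) fun φ => hnat' φ)
      fun a => ?_⟩, ⟨BasedNatIso.mkNatIso (NatIso.ofComponents e fun φ => hnat φ) he⟩⟩
  have h := he (F.obj a)
  rw [F.w_obj] at h
  rw [← F.isHomLift_iff]
  change 𝒴.p.IsHomLift _ (F.map (F.toFunctor.preimage _))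
  rwa [F.toFunctor.map_preimage]

/-- A test object is replaced by an object of the image, by a vertical isomorphism; the universal
property is then transported through fullness and faithfulness. -/
lemma isStronglyCartesian_map [F.toFunctor.Full] [F.toFunctor.Faithful]
    (hF : IsEssSurjOver F) {R S : 𝒮} (f : R ⟶ S) {a b : 𝒳.obj} (φ : a ⟶ b)
    [𝒳.p.IsStronglyCartesian f φ] : 𝒴.p.IsStronglyCartesian f (F.map φ) where
  universal_property' := by
    intro y g ψ hψ
    obtain ⟨x, e, he⟩ := hF y
    have h₁ : 𝒳.p.IsHomLift (g ≫ f) (F.toFunctor.preimage (e.hom ≫ ψ)) := by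
      rw [← F.isHomLift_iff, F.toFunctor.map_preimage]
      infer_instance
    refine ⟨e.inv ≫ F.map (Functor.IsStronglyCartesian.map 𝒳.p f φ (f' := g ≫ f) rfl
      (F.toFunctor.preimage (e.hom ≫ ψ))), ⟨inferInstance, ?_⟩, ?_⟩
    · rw [Category.assoc, ← F.toFunctor.map_comp, Functor.IsStronglyCartesian.fac,
        F.toFunctor.map_preimage, Iso.inv_hom_id_assoc]
    · rintro χ ⟨hχ, hχψ⟩
      have h₂ : 𝒳.p.IsHomLift g (F.toFunctor.preimage (e.hom ≫ χ)) := by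
        rw [← F.isHomLift_iff, F.toFunctor.map_preimage]
        infer_instance
      rw [← Functor.IsStronglyCartesian.map_uniq 𝒳.p f φ (f' := g ≫ f) rfl
        (F.toFunctor.preimage (e.hom ≫ ψ)) (F.toFunctor.preimage (e.hom ≫ χ)) ?_,
        F.toFunctor.map_preimage, Iso.inv_hom_id_assoc]
      exact F.toFunctor.map_injective (by simp [hχψ])

/-- Being fibered is inherited along a fully faithful functor that is essentially surjective over
the base. -/
lemma isFibered_of_fullyFaithful [F.toFunctor.Full] [F.toFunctor.Faithful]
    (hF : IsEssSurjOver F)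
    (h : ∀ (a : 𝒳.obj) (R : 𝒮) (f : R ⟶ 𝒳.p.obj a), ∃ (b : 𝒳.obj) (φ : b ⟶ a),
      𝒳.p.IsStronglyCartesian f φ) : 𝒴.p.IsFibered :=
  Functor.IsFibered.of_exists_isStronglyCartesian fun y R f => by
    obtain ⟨x, e, he⟩ := hF y
    have hx : 𝒳.p.obj x = 𝒴.p.obj y := (F.w_obj x).symm.trans (IsHomLift.domain_eq 𝒴.p (𝟙 _) e.hom)
    -- The target of `f` is generalised so that the propositional equality `hx` can be eliminated.
    have h' : ∀ {S : 𝒮} (_ : 𝒳.p.obj x = S) (f : R ⟶ S), ∃ (b : 𝒳.obj) (φ : b ⟶ x),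
        𝒳.p.IsStronglyCartesian f φ := by
      rintro _ rfl f
      exact h x R f
    obtain ⟨b, φ, hφ⟩ := h' hx f
    have := isStronglyCartesian_map F hF f φ
    have : 𝒴.p.IsStronglyCartesian (f ≫ 𝟙 _) (F.map φ ≫ e.hom) := inferInstance
    exact ⟨F.obj b, F.map φ ≫ e.hom, by simpa using this⟩

end Based

/-! ### Base change of extensions -/

section ExtensionFibered

variable {C : Type u} [SmallCategory C] {J : GrothendieckTopology C} {A : Sheaf J RingCat.{u}}
  {K : SheafOfModules.{u} A}

namespace Extension

instance (ξ : Extension K) : Mono ξ.incl := ξ.exact.mono_f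

instance (ξ : Extension K) : Epi ξ.proj := ξ.exact.epi_g

lemma exists_lift (ξ : Extension K) {N : SheafOfModules.{u} A} (y : N ⟶ ξ.total)
    (hy : y ≫ ξ.proj = 0) : ∃ k : N ⟶ K, k ≫ ξ.incl = y :=
  ⟨ξ.exact.exact.lift y hy, ξ.exact.exact.lift_f y hy⟩

lemma exists_lift_sub (ξ : Extension K) {N : SheafOfModules.{u} A} (y y' : N ⟶ ξ.total)
    (h : y ≫ ξ.proj = y' ≫ ξ.proj) : ∃ k : N ⟶ K, k ≫ ξ.incl + y = y' := by
  obtain ⟨k, hk⟩ := ξ.exists_lift (y' - y) (by rw [Preadditive.sub_comp, h, sub_self])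
  exact ⟨k, by rw [hk, sub_add_cancel]⟩

lemma shortExact_baseChange (ξ : Extension K) {N : SheafOfModules.{u} A} (f : N ⟶ ξ.base)
    (w : pullback.lift ξ.incl 0 (by rw [ξ.w, zero_comp]) ≫ pullback.snd ξ.proj f = 0) :
    (ShortComplex.mk _ _ w).ShortExact := by
  have hlift {W : SheafOfModules.{u} A} (t : W ⟶ pullback ξ.proj f)
      (ht : t ≫ pullback.snd ξ.proj f = 0) : (t ≫ pullback.fst ξ.proj f) ≫ ξ.proj = 0 := by
    rw [Category.assoc, pullback.condition, ← Category.assoc, ht, zero_comp]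
  have hfac {W : SheafOfModules.{u} A} (t : W ⟶ pullback ξ.proj f)
      (ht : t ≫ pullback.snd ξ.proj f = 0) :
      ξ.exact.exact.lift _ (hlift t ht) ≫ ξ.incl = t ≫ pullback.fst ξ.proj f :=
    ξ.exact.exact.lift_f _ (hlift t ht)
  have hfst : pullback.lift ξ.incl 0 (by rw [ξ.w, zero_comp]) ≫ pullback.fst ξ.proj f = ξ.incl :=
    pullback.lift_fst _ _ _
  have hmono := mono_of_mono_fac hfst
  have hepi : Epi (pullback.snd ξ.proj f) := inferInstance
  refine { exact := ShortComplex.exact_of_f_is_kernel _ (KernelFork.IsLimit.ofι _ _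
            (fun t ht => ξ.exact.exact.lift _ (hlift t ht)) (fun t ht => ?_)
            fun t ht m hm => ?_)
           mono_f := hmono
           epi_g := hepi }
  · refine pullback.hom_ext ?_ ?_
    · rw [Category.assoc, hfst]
      exact hfac t ht
    · rw [Category.assoc, w, comp_zero]
      exact ht.symm
  · rw [← cancel_mono ξ.incl, hfac t ht, ← hm, Category.assoc, hfst]

/-- The pullback of an extension along a map to its base. -/
noncomputable def baseChange (ξ : Extension K) {N : SheafOfModules.{u} A} (f : N ⟶ ξ.base) :
    Extension K where
  base := N
  total := pullback ξ.proj f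
  incl := pullback.lift ξ.incl 0 (by rw [ξ.w, zero_comp])
  proj := pullback.snd ξ.proj f
  w := pullback.lift_snd _ _ _
  exact := ξ.shortExact_baseChange f _

/-- The projection of the pullback of an extension. -/
noncomputable def baseChangeHom (ξ : Extension K) {N : SheafOfModules.{u} A} (f : N ⟶ ξ.base) :
    ξ.baseChange f ⟶ ξ where
  base := f
  total := pullback.fst ξ.proj f
  incl_total := pullback.lift_fst _ _ _
  total_proj := pullback.condition

/-- The comparison with the base change of `η` is the identity on `K` and on the base, so it is an
isomorphism by the short five lemma. -/
lemma Hom.isPullback {ξ η : Extension K} (φ : ξ ⟶ η) :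
    IsPullback (Hom.total φ) ξ.proj η.proj (Hom.base φ) := by
  let ζ := η.baseChange (Hom.base φ)
  let t : ξ.total ⟶ ζ.total := pullback.lift (Hom.total φ) ξ.proj (Hom.total_proj φ)
  have ht : t ≫ ζ.proj = ξ.proj := pullback.lift_snd _ _ _
  have ht' : ξ.incl ≫ t = ζ.incl := by
    refine pullback.hom_ext ?_ ?_
    · exact (Category.assoc _ _ _).trans ((congrArg _ (pullback.lift_fst _ _ _)).trans
        ((Hom.incl_total φ).trans (pullback.lift_fst _ _ _).symm))
    · exact (Category.assoc _ _ _).trans ((congrArg _ ht).trans (ξ.w.trans ζ.w.symm))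
  let S₁ := ShortComplex.mk ξ.incl ξ.proj ξ.w
  let S₂ := ShortComplex.mk ζ.incl ζ.proj ζ.w
  let Φ : S₁ ⟶ S₂ := { τ₁ := 𝟙 K, τ₂ := t, τ₃ := 𝟙 ξ.base, comm₁₂ := ?_, comm₂₃ := ?_ }
  · have h₁ : IsIso Φ.τ₁ := inferInstanceAs (IsIso (𝟙 K))
    have h₃ : IsIso Φ.τ₃ := inferInstanceAs (IsIso (𝟙 ξ.base))
    have hiso : IsIso Φ.τ₂ := ShortComplex.isIso₂_of_shortExact_of_isIso₁₃ Φ ξ.exact ζ.exact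
    exact IsPullback.of_iso_pullback ⟨Hom.total_proj φ⟩
      (@asIso _ _ ξ.total (pullback η.proj (Hom.base φ)) t hiso) (pullback.lift_fst _ _ _) ht
  · exact (Category.id_comp _).trans ht'.symm
  · exact ht.trans (Category.comp_id _).symm

lemma isHomLift_iff {ξ η : Extension K} (f : ξ.base ⟶ η.base) (φ : ξ ⟶ η) :
    (extensionsOver K).p.IsHomLift f φ ↔ Hom.base φ = f := by
  constructor
  · intro h
    exact (@IsHomLift.eq_of_isHomLift _ _ _ _ (extensionsOver K).p ξ η f φ h).symm
  · rintro rfl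
    exact IsHomLift.map (p := (extensionsOver K).p) φ

lemma isStronglyCartesian {ξ η : Extension K} (φ : ξ ⟶ η) :
    (extensionsOver K).p.IsStronglyCartesian (Hom.base φ) φ where
  toIsHomLift := IsHomLift.map (p := (extensionsOver K).p) φ
  universal_property' := by
    intro (ζ : Extension K) (g : ζ.base ⟶ ξ.base) (ψ : ζ ⟶ η) hψ
    have hψ' : Hom.base ψ = g ≫ Hom.base φ := (isHomLift_iff _ _).1 hψ
    have hP := Hom.isPullback φ
    let t : ζ.total ⟶ ξ.total := hP.lift (Hom.total ψ) (ζ.proj ≫ g) (by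
      rw [Category.assoc, ← hψ', Hom.total_proj])
    let χ : ζ ⟶ ξ :=
      { base := g
        total := t
        incl_total := hP.hom_ext
          (by rw [Category.assoc, hP.lift_fst, Hom.incl_total, Hom.incl_total])
          (by rw [Category.assoc, hP.lift_snd, ← Category.assoc, ζ.w, ξ.w, zero_comp])
        total_proj := hP.lift_snd _ _ _ }
    refine ⟨χ, ⟨(isHomLift_iff _ _).2 rfl, Hom.ext hψ'.symm (hP.lift_fst _ _ _)⟩, ?_⟩
    rintro (χ' : ζ ⟶ ξ) ⟨h, rfl⟩
    have h' := (isHomLift_iff _ _).1 h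
    refine Hom.ext h' (hP.hom_ext (hP.lift_fst _ _ _).symm ?_)
    refine Eq.trans ?_ (hP.lift_snd _ _ _).symm
    rw [Hom.total_proj, h']

end Extension

lemma exists_isStronglyCartesian_extensionsOver (a : (extensionsOver K).obj)
    (R : SheafOfModules.{u} A) (f : R ⟶ (extensionsOver K).p.obj a) :
    ∃ (b : (extensionsOver K).obj) (φ : b ⟶ a),
      (extensionsOver K).p.IsStronglyCartesian f φ :=
  ⟨Extension.baseChange a f, Extension.baseChangeHom a f,
    Extension.isStronglyCartesian (Extension.baseChangeHom a f)⟩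

lemma isFibered_extensionsOver (K : SheafOfModules.{u} A) : (extensionsOver K).p.IsFibered :=
  Functor.IsFibered.of_exists_isStronglyCartesian exists_isStronglyCartesian_extensionsOver

end ExtensionFibered

/-! ### The torsor of an extension, and torsors as families of sections -/

section Torsors

variable {C : Type u} [SmallCategory C] {J : GrothendieckTopology C} {A : Sheaf J RingCat.{u}}
  {K : SheafOfModules.{u} A}

/-- Subcanonicity gives the sheaf condition and exactness gives the unique difference in `K`. The
sieve generated by the epimorphism `ξ.proj` is covering, and its members lift to the middle term by
definition. -/
lemma Extension.isTorsor (ξ : Extension K) : ξ.toActedPresheaf.IsTorsor where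
  isSheaf := (isSheaf_iff_isSheaf_of_type _ _).2
    (GrothendieckTopology.Subcanonical.isSheaf_of_isRepresentable (J := (aModTopology A).over ξ.base)
      (yoneda.obj (Over.mk ξ.proj)))
  free_transitive X (s t : X ⟶ Over.mk ξ.proj) := by
    obtain ⟨k, hk⟩ := ξ.exists_lift_sub (ξ.toTotal s) (ξ.toTotal t)
      ((ξ.toTotal_proj s).trans (ξ.toTotal_proj t).symm)
    refine ⟨k, Over.OverMorphism.ext hk, fun l hl => ?_⟩
    have hl' : l ≫ ξ.incl + ξ.toTotal s = ξ.toTotal t := congrArg CommaMorphism.left hl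
    rw [← cancel_mono ξ.incl]
    exact add_right_cancel (hl'.trans hk.symm)
  locally_sections := ⟨Sieve.generateSingleton ξ.proj, aModTopology_generateSingleton_mem ξ.proj,
    fun _ _ ⟨g, hg⟩ => ⟨(Over.homMk g hg : Over.mk _ ⟶ Over.mk ξ.proj)⟩⟩

namespace ActedPresheaf

/-- The sections of a torsor on `A-mod/M`, as a family indexed by the maps to `M`. -/
def IsTorsor.toTorsorOver {P : ActedPresheaf K} (hP : P.IsTorsor) :
    TorsorOver.{u, u + 1, u} (aModTopology A) P.base K where
  sec x := P.carrier.obj (op (Over.mk x))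
  res f h := P.carrier.map (Over.homMk f h : Over.mk _ ⟶ Over.mk _).op
  res_id _ s := map_eq_self P.carrier _ rfl s
  res_res f hf g hg s := map_map P.carrier _ _ _ rfl s
  act {X x} k s := P.act (Over.mk x) k s
  zero_act {X x} s := P.zero_act (Over.mk x) s
  add_act {X x} k l s := P.add_act (Over.mk x) k l s
  res_act f hf k s := P.map_act _ _ _ k s
  free_transitive {X x} s t := hP.free_transitive (Over.mk x) s t
  exists_glue {X} x S hS s hs := by
    let S' : Sieve (Over.mk x) := (Sieve.overEquiv (Over.mk x)).symm S
    have hS' : S' ∈ (aModTopology A).over P.base (Over.mk x) := by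
      rw [GrothendieckTopology.mem_over_iff, OrderIso.apply_symm_apply]
      exact hS
    let F : Presieve.FamilyOfElements P.carrier S'.arrows := fun Y f hf =>
      P.carrier.map (Over.homMk (𝟙 _) (by simpa using Over.w f) :
        Y ⟶ Over.mk (f.left ≫ x)).op (s f.left ((Sieve.overEquiv_symm_iff _ _).1 hf))
    have hF : F.SieveCompatible := fun Y Z f g hf => by
      have := hs f.left ((Sieve.overEquiv_symm_iff _ _).1 hf) g.left
      have hfx : f.left ≫ x = Y.hom := Over.w f
      have hw : g.left ≫ f.left ≫ x = Z.hom := by rw [hfx, Over.w g]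
      let h : Z ⟶ Over.mk (f.left ≫ x) := Over.homMk g.left hw
      exact (congrArg _ this.symm).trans
        ((map_map P.carrier _ _ h (Category.id_comp _) _).trans
          (map_map P.carrier _ g h (Category.comp_id _) _).symm)
    obtain ⟨t, ht, -⟩ := (isSheaf_iff_isSheaf_of_type _ _).1 hP.isSheaf S' hS' F
      ((Presieve.compatible_iff_sieveCompatible F).2 hF)
    refine ⟨t, fun Y f hf => ?_⟩
    have := ht (Over.homMk f rfl : Over.mk (f ≫ x) ⟶ Over.mk x)
      ((Sieve.overEquiv_symm_iff _ _).2 hf)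
    exact this.trans (map_eq_self P.carrier _ rfl _)
  locally_nonempty := hP.locally_sections

end ActedPresheaf

end Torsors

/-! ### Full faithfulness of `rho` and representability of torsors -/

section RhoEquivalence

variable {C : Type u} [SmallCategory C] {J : GrothendieckTopology C} {A : Sheaf J RingCat.{u}}
  {K : SheafOfModules.{u} A}

namespace Extension

/-- The image of the identity of the middle term under a morphism of represented presheaves. -/
def totalOfHom {ξ η : Extension K}
    (φ : ActedPresheaf.Hom ξ.toActedPresheaf η.toActedPresheaf) : ξ.total ⟶ η.total :=
  η.toTotal (X := (Over.map φ.base).obj (Over.mk ξ.proj)) (φ.app (Over.mk ξ.proj) (𝟙 _))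

lemma totalOfHom_proj {ξ η : Extension K}
    (φ : ActedPresheaf.Hom ξ.toActedPresheaf η.toActedPresheaf) :
    totalOfHom φ ≫ η.proj = ξ.proj ≫ φ.base :=
  η.toTotal_proj (X := (Over.map φ.base).obj (Over.mk ξ.proj)) (φ.app (Over.mk ξ.proj) (𝟙 _))

lemma toTotal_app {ξ η : Extension K}
    (φ : ActedPresheaf.Hom ξ.toActedPresheaf η.toActedPresheaf) {X : Over ξ.base}
    (s : X ⟶ Over.mk ξ.proj) :
    η.toTotal (X := (Over.map φ.base).obj X) (φ.app X s) = ξ.toTotal s ≫ totalOfHom φ := by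
  have h := φ.naturality _ _ s (𝟙 (Over.mk ξ.proj))
  have e : ξ.toActedPresheaf.carrier.map s.op (𝟙 (Over.mk ξ.proj)) = s := Category.comp_id s
  exact congrArg CommaMorphism.left ((congrArg (φ.app X) e.symm).trans h)

/-- Equivariance is applied to the zero section over the zero map `K → M`, translated by the
identity of `K`: the translate is `ξ.incl` on one side and `η.incl` on the other. -/
lemma incl_totalOfHom {ξ η : Extension K}
    (φ : ActedPresheaf.Hom ξ.toActedPresheaf η.toActedPresheaf) :
    ξ.incl ≫ totalOfHom φ = η.incl := by
  let X : Over ξ.base := Over.mk (0 : K ⟶ ξ.base)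
  let s : X ⟶ Over.mk ξ.proj := ξ.ofTotal 0 zero_comp
  have h := congrArg CommaMorphism.left (φ.app_act X (𝟙 K) s)
  have h₁ := toTotal_app φ (ξ.toActedPresheaf.act X (𝟙 K) s)
  have h₂ := toTotal_app φ s
  have e₁ : ξ.toTotal (ξ.toActedPresheaf.act X (𝟙 K) s) = ξ.incl := by
    change 𝟙 K ≫ ξ.incl + (0 : K ⟶ ξ.total) = _
    rw [Category.id_comp, add_zero]
  rw [e₁] at h₁
  have e₂ : ξ.toTotal s = 0 := rfl
  rw [e₂, zero_comp] at h₂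
  refine h₁.symm.trans (h.trans ?_)
  refine (congrArg (fun t : K ⟶ η.total => 𝟙 K ≫ η.incl + t) h₂).trans ?_
  rw [Category.id_comp, add_zero]

end Extension

instance : (rhoActed K).Faithful where
  map_injective {ξ η} f g h := by
    refine Extension.Hom.ext (congrArg ActedPresheaf.Hom.base h) ?_
    have := congrArg Extension.totalOfHom h
    exact (Category.id_comp _).symm.trans (this.trans (Category.id_comp _))

instance : (rhoActed K).Full where
  map_surjective {ξ η} φ := by
    refine ⟨{ base := ActedPresheaf.Hom.base φ
              total := Extension.totalOfHom φ
              incl_total := Extension.incl_totalOfHom φ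
              total_proj := Extension.totalOfHom_proj φ }, ?_⟩
    refine ActedPresheaf.Hom.ext' rfl fun X s => Over.OverMorphism.ext ?_
    exact (Category.id_comp _).trans (Extension.toTotal_app φ s).symm

instance (h : ∀ ξ : Extension K, ξ.toActedPresheaf.IsTorsor) : (rho K h).toFunctor.Faithful where
  map_injective {_ _ _ _} hfg := (rhoActed K).map_injective (congrArg (fun φ => φ.hom) hfg)

instance (h : ∀ ξ : Extension K, ξ.toActedPresheaf.IsTorsor) : (rho K h).toFunctor.Full where
  map_surjective φ := by
    obtain ⟨f, hf⟩ := (rhoActed K).map_surjective φ.hom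
    exact ⟨f, InducedCategory.Hom.ext hf⟩

/-- Every torsor is isomorphic to the one represented by an extension, by an isomorphism over the
identity. -/
lemma ActedPresheaf.IsTorsor.exists_iso {P : ActedPresheaf K} (hP : P.IsTorsor) :
    ∃ (ξ : Extension K) (hξ : ξ.base = P.base) (e : (rhoActed K).obj ξ ≅ P),
      ActedPresheaf.Hom.base e.hom = eqToHom hξ := by
  let Q := hP.toTorsorOver
  obtain ⟨E, i, p, w, u, hE, hu⟩ := Q.exists_extension (isFinitelyLifting_aModTopology A)
  let ξ : Extension K := ⟨P.base, E, i, p, w, hE⟩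
  let φ : ActedPresheaf.Hom ξ.toActedPresheaf P :=
    { base := 𝟙 P.base
      app := fun X (s : X ⟶ Over.mk p) => Q.res (y := X.hom ≫ 𝟙 P.base) s.left
        ((Over.w s).trans (Category.comp_id _).symm) u
      naturality := fun X Y f (s : X ⟶ Over.mk p) => (map_map P.carrier _ _ _ rfl u).symm
      app_act := fun X k (s : X ⟶ Over.mk p) =>
        TorsorOver.res_incl_add hu k s.left _ ((Over.w s).trans (Category.comp_id _).symm) }
  -- The inverse sends a section to the unique map to `E` pulling `u` back to it; uniqueness yields
  -- naturality and equivariance.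
  have hrep (X : Over P.base) (s : P.carrier.obj (op X)) :=
    (TorsorOver.existsUnique_res_eq hu hE (x := X.hom) s).exists
  choose y hy hys using hrep
  have huniq {X : Over P.base} {s : P.carrier.obj (op X)} {z : X.left ⟶ E} (hz : z ≫ p = X.hom)
      (hzs : Q.res z hz u = s) : y X s = z :=
    (TorsorOver.existsUnique_res_eq hu hE (x := X.hom) s).unique ⟨hy X s, hys X s⟩ ⟨hz, hzs⟩
  let ψ : ActedPresheaf.Hom P ξ.toActedPresheaf :=
    { base := 𝟙 P.base
      app := fun X s => ξ.ofTotal (X := (Over.map (𝟙 P.base)).obj X) (y X s)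
        ((hy X s).trans (Category.comp_id _).symm)
      naturality := fun X Y f s => Over.OverMorphism.ext <| by
        change y Y _ = f.left ≫ y X s
        refine huniq (by rw [Category.assoc, hy, Over.w]) ?_
        refine Eq.trans ?_ (congrArg (P.carrier.map f.op) (hys X s))
        exact (map_map P.carrier _ _ _ rfl u).symm
      app_act := fun X k s => Over.OverMorphism.ext <| by
        change y X _ = k ≫ i + y X s
        refine huniq (by rw [Preadditive.add_comp, Category.assoc, w, comp_zero, zero_add, hy]) ?_
        rw [TorsorOver.res_incl_add hu _ _ _ (hy X s), hys]
        rfl }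
  refine ⟨ξ, rfl, ⟨φ, ψ, ?_, ?_⟩, rfl⟩
  · refine ActedPresheaf.Hom.ext' (Category.comp_id (𝟙 P.base)) fun X s =>
      Over.OverMorphism.ext ?_
    refine (congrArg (𝟙 X.left ≫ ·) ((Category.id_comp _).trans
      (huniq (X := (Over.map (𝟙 P.base)).obj X) (z := ξ.toTotal s)
        ((ξ.toTotal_proj s).trans (Category.comp_id _).symm) rfl))).trans ?_
    rfl
  · refine ActedPresheaf.Hom.ext' (Category.comp_id (𝟙 P.base)) fun X s => ?_
    let h₁ : Over.mk ((X.hom ≫ 𝟙 P.base) ≫ 𝟙 P.base) ⟶ Over.mk p :=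
      Over.homMk (y X s) (by simp [hy])
    let h₂ : Over.mk (X.hom ≫ 𝟙 P.base ≫ 𝟙 P.base) ⟶ Over.mk p :=
      Over.homMk (y X s) (by simp [hy])
    let h₃ : Over.mk (X.hom ≫ 𝟙 P.base) ⟶ Over.mk p := Over.homMk (y X s) (by simp [hy])
    refine (congrArg _ (map_map P.carrier h₁ (overCast (Category.assoc _ _ _).symm) h₂
      (Category.id_comp _) u)).trans ?_
    refine (map_map P.carrier h₂ (overCast (by simp)) h₃ (Category.id_comp _) u).trans ?_
    refine Eq.trans ?_ (congrArg (P.carrier.map (overCast (Category.comp_id _)).op) (hys X s))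
    exact (map_map P.carrier _ _ h₃ (Category.id_comp _) u).symm

end RhoEquivalence

/-! ### The equivalence over the base -/

section RhoBased

variable {C : Type u} [SmallCategory C] {J : GrothendieckTopology C} {A : Sheaf J RingCat.{u}}
  {K : SheafOfModules.{u} A}

lemma isEssSurjOver_rho (h : ∀ ξ : Extension K, ξ.toActedPresheaf.IsTorsor) :
    IsEssSurjOver (rho K h) := fun P => by
  obtain ⟨ξ, hξ, e, he⟩ := P.property.exists_iso
  refine ⟨ξ, ObjectProperty.isoMk _ e, ?_⟩
  refine IsHomLift.of_fac (torsorsOver K).p _ _ hξ rfl ?_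
  have : (torsorsOver K).p.map (ObjectProperty.isoMk ActedPresheaf.IsTorsor e :
      (rho K h).obj ξ ≅ P).hom = eqToHom hξ := he
  rw [this]
  exact ((congrArg (eqToHom hξ.symm ≫ ·) (Category.comp_id (eqToHom hξ))).trans (eqToHom_trans _ _)).symm

/-- Cartesian lifts of torsors are obtained from base changes of extensions through `rho`. -/
lemma isFibered_torsorsOver (h : ∀ ξ : Extension K, ξ.toActedPresheaf.IsTorsor) :
    (torsorsOver K).p.IsFibered :=
  isFibered_of_fullyFaithful (rho K h) (isEssSurjOver_rho h)
    exists_isStronglyCartesian_extensionsOver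

lemma isEquivalenceOver_rho (h : ∀ ξ : Extension K, ξ.toActedPresheaf.IsTorsor) :
    IsEquivalenceOver (rho K h) :=
  isEquivalenceOver_of_fullyFaithful (rho K h) (isEssSurjOver_rho h)

end RhoBased

/-! ### Functors to extensions, seen as families -/

section ExtensionFamily

variable {C : Type u} [SmallCategory C] {J : GrothendieckTopology C} {A : Sheaf J RingCat.{u}}
  {K : SheafOfModules.{u} A}

namespace ExtensionFamily

variable {𝒵 : BasedCategory.{v₂, u₂} (SheafOfModules.{u} A)}
  (F G : BasedFunctor 𝒵 (extensionsOver K))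

/-- The extension attached to `X` by a functor to extensions. -/
def ext (X : 𝒵.obj) : Extension K := F.obj X

/-- The middle term of the extension attached to `X`. -/
abbrev total (X : 𝒵.obj) : SheafOfModules.{u} A := (ext F X).total

/-- The inclusion of `K` in the middle term. -/
abbrev incl (X : 𝒵.obj) : K ⟶ total F X := (ext F X).incl

/-- A functor over the base respects projections only up to propositional equality. `proj` absorbs
the resulting `eqToHom`, so that the pullback squares lie over the arrows of the base themselves. -/
lemma ext_base (X : 𝒵.obj) : (ext F X).base = 𝒵.p.obj X := F.w_obj X

/-- The projection of the middle term to the object of the base below `X`. -/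
def proj (X : 𝒵.obj) : total F X ⟶ 𝒵.p.obj X := (ext F X).proj ≫ eqToHom (ext_base F X)

instance epi_proj (X : 𝒵.obj) : Epi (proj F X) :=
  inferInstanceAs (Epi ((ext F X).proj ≫ eqToHom (ext_base F X)))

/-- The morphism of extensions attached to an arrow. -/
def homExt {X Y : 𝒵.obj} (φ : X ⟶ Y) : ext F X ⟶ ext F Y := F.map φ

/-- The map of middle terms attached to an arrow. -/
def map {X Y : 𝒵.obj} (φ : X ⟶ Y) : total F X ⟶ total F Y := Extension.Hom.total (homExt F φ)

lemma map_comp {X Y Z : 𝒵.obj} (φ : X ⟶ Y) (ψ : Y ⟶ Z) : map F (φ ≫ ψ) = map F φ ≫ map F ψ :=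
  congrArg Extension.Hom.total (F.toFunctor.map_comp φ ψ)

lemma map_id (X : 𝒵.obj) : map F (𝟙 X) = 𝟙 _ :=
  congrArg Extension.Hom.total (F.toFunctor.map_id X)

@[simp]
lemma incl_map {X Y : 𝒵.obj} (φ : X ⟶ Y) : incl F X ≫ map F φ = incl F Y :=
  Extension.Hom.incl_total (homExt F φ)

@[simp]
lemma incl_proj (X : 𝒵.obj) : incl F X ≫ proj F X = 0 := by
  rw [proj, ← Category.assoc, (ext F X).w, zero_comp]

lemma homExt_base {X Y : 𝒵.obj} (φ : X ⟶ Y) :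
    Extension.Hom.base (homExt F φ) ≫ eqToHom (ext_base F Y) =
      eqToHom (ext_base F X) ≫ 𝒵.p.map φ := by
  have : (extensionsOver K).p.IsHomLift (𝒵.p.map φ) (F.map φ) := inferInstance
  exact (IsHomLift.commSq (extensionsOver K).p (𝒵.p.map φ) (F.map φ)).w

lemma isPullback {X Y : 𝒵.obj} (φ : X ⟶ Y) :
    IsPullback (map F φ) (proj F X) (proj F Y) (𝒵.p.map φ) :=
  IsPullback.of_iso (Extension.Hom.isPullback (homExt F φ)) (Iso.refl _) (Iso.refl _)
    (eqToIso (ext_base F X)) (eqToIso (ext_base F Y))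
    ((Category.comp_id _).trans (Category.id_comp _).symm)
    (Category.id_comp _).symm (Category.id_comp _).symm (homExt_base F φ)

lemma exists_lift (X : 𝒵.obj) {N : SheafOfModules.{u} A} (y y' : N ⟶ total F X)
    (h : y ≫ proj F X = y' ≫ proj F X) : ∃ k : N ⟶ K, k ≫ incl F X + y = y' := by
  refine (ext F X).exists_lift_sub y y' ?_
  rw [proj, ← Category.assoc, ← Category.assoc] at h
  exact (cancel_mono _).1 h

variable {F G}

/-- The morphism of extensions underlying the component of a natural transformation. -/
def appExt (α : F ⟶ G) (X : 𝒵.obj) : ext F X ⟶ ext G X := α.toNatTrans.app X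

/-- The map of middle terms given by a natural transformation. -/
def app (α : F ⟶ G) (X : 𝒵.obj) : total F X ⟶ total G X := Extension.Hom.total (appExt α X)

lemma naturality (α : F ⟶ G) {X Y : 𝒵.obj} (φ : X ⟶ Y) :
    map F φ ≫ app α Y = app α X ≫ map G φ :=
  congrArg Extension.Hom.total (α.toNatTrans.naturality φ)

@[simp]
lemma incl_app (α : F ⟶ G) (X : 𝒵.obj) : incl F X ≫ app α X = incl G X :=
  Extension.Hom.incl_total (appExt α X)

lemma appExt_base (α : F ⟶ G) (X : 𝒵.obj) :
    Extension.Hom.base (appExt α X) = eqToHom ((ext_base F X).trans (ext_base G X).symm) := by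
  have := IsHomLift.fac' (extensionsOver K).p (𝟙 (𝒵.p.obj X)) (α.toNatTrans.app X)
  refine this.trans ?_
  rw [Category.id_comp]
  exact eqToHom_trans _ _

lemma app_proj (α : F ⟶ G) (X : 𝒵.obj) : app α X ≫ proj G X = proj F X := by
  rw [proj, ← Category.assoc, app, Extension.Hom.total_proj, appExt_base]
  simp [proj]

lemma hom_ext {α β : F ⟶ G} (h : ∀ X, app α X = app β X) : α = β := by
  refine BasedNatTrans.ext _ _ (NatTrans.ext (funext fun X => ?_))
  exact Extension.Hom.ext ((appExt_base α X).trans (appExt_base β X).symm) (h X)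

lemma exists_hom (t : ∀ X, total F X ⟶ total G X) (ht : ∀ X, incl F X ≫ t X = incl G X)
    (ht' : ∀ X, t X ≫ proj G X = proj F X)
    (h : ∀ ⦃X Y⦄ (φ : X ⟶ Y), map F φ ≫ t Y = t X ≫ map G φ) :
    ∃ α : F ⟶ G, ∀ X, app α X = t X := by
  have hb (X : 𝒵.obj) : (ext F X).base = (ext G X).base := (ext_base F X).trans (ext_base G X).symm
  let a (X : 𝒵.obj) : Extension.Hom (ext F X) (ext G X) :=
    { base := eqToHom (hb X)
      total := t X
      incl_total := ht X
      total_proj := by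
        rw [← cancel_mono (eqToHom (ext_base G X)), Category.assoc]
        refine (ht' X).trans ?_
        simp [proj] }
  let α₀ : F.toFunctor ⟶ G.toFunctor :=
    { app := a
      naturality := fun X Y φ => Extension.Hom.ext (by
        change Extension.Hom.base (homExt F φ) ≫ eqToHom (hb Y) =
          eqToHom (hb X) ≫ Extension.Hom.base (homExt G φ)
        rw [← cancel_mono (eqToHom (ext_base G Y)), Category.assoc, Category.assoc, homExt_base,
          eqToHom_trans, homExt_base, eqToHom_trans_assoc]) (h φ) }
  refine ⟨{ toNatTrans := α₀, isHomLift' := fun X => ?_ }, fun X => rfl⟩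
  refine IsHomLift.of_fac' (extensionsOver K).p _ _ (ext_base F X) (ext_base G X) ?_
  rw [Category.id_comp]
  exact (eqToHom_trans _ _).symm

/-- Each component is a cartesian arrow over an isomorphism. -/
lemma isIso_hom (α : F ⟶ G) : IsIso α := by
  have (X : 𝒵.obj) : IsIso (α.toNatTrans.app X) := by
    have h : (extensionsOver K).p.IsStronglyCartesian
      ((extensionsOver K).p.map (α.toNatTrans.app X)) (α.toNatTrans.app X) :=
      Extension.isStronglyCartesian (appExt α X)
    have : IsIso ((extensionsOver K).p.map (α.toNatTrans.app X)) := by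
      have e : (extensionsOver K).p.map (α.toNatTrans.app X) = _ := appExt_base α X
      rw [e]
      exact inferInstanceAs (IsIso (eqToHom ((ext_base F X).trans (ext_base G X).symm)))
    exact Functor.IsStronglyCartesian.isIso_of_base_isIso (extensionsOver K).p
      ((extensionsOver K).p.map (α.toNatTrans.app X)) _
  have : IsIso (X := F.toFunctor) α.toNatTrans := NatIso.isIso_of_isIso_app α.toNatTrans
  exact BasedNatIso.isIso_of_toNatTrans_isIso α

lemma sendsToCartesian (F : BasedFunctor 𝒵 (extensionsOver K)) :
    _root_.sendsToCartesian 𝒵 (extensionsOver K) F :=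
  fun _ _ φ => Extension.isStronglyCartesian (homExt F φ)

end ExtensionFamily

end ExtensionFamily

/-! ### Descent of morphisms of extensions -/

section SubcanonicalGluing

variable {𝒜 : Type u₁} [Category.{v₁} 𝒜] (T : GrothendieckTopology 𝒜) [T.Subcanonical]

lemma eq_of_comp_eq_of_mem {X N : 𝒜} {S : Sieve X} (hS : S ∈ T X) {t t' : X ⟶ N}
    (h : ∀ ⦃W : 𝒜⦄ (w : W ⟶ X), S w → w ≫ t = w ≫ t') : t = t' :=
  (GrothendieckTopology.Subcanonical.isSheaf_of_isRepresentable (J := T)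
    (yoneda.obj N)).isSeparated S hS |>.ext fun _ w hw => h w hw

lemma exists_comp_eq_of_mem {X N : 𝒜} {S : Sieve X} (hS : S ∈ T X)
    (s : ∀ ⦃W : 𝒜⦄ (w : W ⟶ X), S w → (W ⟶ N))
    (hs : ∀ ⦃W V : 𝒜⦄ (w : W ⟶ X) (hw : S w) (v : V ⟶ W),
      v ≫ s w hw = s (v ≫ w) (S.downward_closed hw v)) :
    ∃ t : X ⟶ N, ∀ ⦃W : 𝒜⦄ (w : W ⟶ X) (hw : S w), w ≫ t = s w hw := by
  obtain ⟨t, ht, -⟩ := GrothendieckTopology.Subcanonical.isSheaf_of_isRepresentable (J := T)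
    (yoneda.obj N) S hS s ((Presieve.compatible_iff_sieveCompatible _).2
      fun _ _ w v hw => (hs w hw v).symm)
  exact ⟨t, fun W w hw => ht w hw⟩

end SubcanonicalGluing

section SliceFamily

variable {C : Type u} [SmallCategory C] {J : GrothendieckTopology C} {A : Sheaf J RingCat.{u}}
  {K : SheafOfModules.{u} A}

namespace ExtensionFamily

variable {M : SheafOfModules.{u} A} (F G : BasedFunctor (overFibered M) (extensionsOver K))

/-- The middle term, for a family of extensions on the slice over `M`. -/
def overTotal (X : Over M) : SheafOfModules.{u} A := total F X

/-- The inclusion of `K` in the middle term, for a family of extensions on the slice over `M`. -/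
def overIncl (X : Over M) : K ⟶ overTotal F X := incl F X

/-- The projection of the middle term, for a family of extensions on the slice over `M`. -/
def overProj (X : Over M) : overTotal F X ⟶ X.left := proj F X

/-- The map of middle terms, for a family of extensions on the slice over `M`. -/
def overMap {X Y : Over M} (φ : X ⟶ Y) : overTotal F X ⟶ overTotal F Y :=
  map (𝒵 := overFibered M) F φ

lemma isPullback_over {X Y : Over M} (φ : X ⟶ Y) :
    IsPullback (overMap F φ) (overProj F X) (overProj F Y) φ.left :=
  isPullback (𝒵 := overFibered M) F φ

lemma overMap_comp {X Y Z : Over M} (φ : X ⟶ Y) (ψ : Y ⟶ Z) :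
    overMap F (φ ≫ ψ) = overMap F φ ≫ overMap F ψ :=
  map_comp (𝒵 := overFibered M) F φ ψ

lemma overMap_id (X : Over M) : overMap F (𝟙 X) = 𝟙 _ := map_id (𝒵 := overFibered M) F X

@[simp]
lemma incl_overMap {X Y : Over M} (φ : X ⟶ Y) : overIncl F X ≫ overMap F φ = overIncl F Y :=
  incl_map (𝒵 := overFibered M) F φ

variable {F} in
-- A map `t` from `W` to a middle term is the same as a section of the extension pulled back to `W`.
-- This lift `σ` of `t` is universal: every other lift is induced from it.
lemma exists_factor {X : Over M} {W : SheafOfModules.{u} A} (t : W ⟶ overTotal F X) :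
    ∃ σ : W ⟶ overTotal F (Over.mk (t ≫ overProj F X ≫ X.hom)),
      σ ≫ overMap F (Over.homMk (t ≫ overProj F X) (Category.assoc _ _ _)) = t ∧
      ∀ {Y : Over M} (φ : Y ⟶ X) (s : W ⟶ overTotal F Y) (_ : s ≫ overMap F φ = t),
        ∃ ψ : Over.mk (t ≫ overProj F X ≫ X.hom) ⟶ Y,
          ψ ≫ φ = Over.homMk (t ≫ overProj F X) (Category.assoc _ _ _) ∧
            σ ≫ overMap F ψ = s := by
  let Y₀ := Over.mk (t ≫ overProj F X ≫ X.hom)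
  let φ₀ : Y₀ ⟶ X := Over.homMk (t ≫ overProj F X) (Category.assoc _ _ _)
  have H := isPullback_over F φ₀
  have hw : t ≫ overProj F X = 𝟙 W ≫ φ₀.left := (Category.id_comp _).symm
  refine ⟨H.lift t (𝟙 W) hw, H.lift_fst _ _ _, fun {Y} φ s hs => ?_⟩
  have hφ : (s ≫ overProj F Y) ≫ φ.left = t ≫ overProj F X := by
    rw [← hs, Category.assoc, Category.assoc, (isPullback_over F φ).w]
  let ψ : Y₀ ⟶ Y := Over.homMk (s ≫ overProj F Y) (by
    change _ = t ≫ overProj F X ≫ X.hom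
    rw [← Category.assoc t, ← hφ, Category.assoc _ φ.left, Over.w φ])
  have hψ : ψ ≫ φ = φ₀ := Over.OverMorphism.ext hφ
  refine ⟨ψ, hψ, (isPullback_over F φ).hom_ext ?_ ?_⟩
  · rw [Category.assoc, ← overMap_comp, hψ, hs]
    exact H.lift_fst _ _ _
  · rw [Category.assoc, (isPullback_over F ψ).w, ← Category.assoc]
    refine (congrArg (· ≫ ψ.left) (H.lift_snd _ _ hw)).trans (Category.id_comp _)

variable {R : Sieve M}

lemma pullback_mem (hR : R ∈ aModTopology A M) (X : Over M) :
    R.pullback (overProj F X ≫ X.hom) ∈ aModTopology A (overTotal F X) :=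
  (aModTopology A).pullback_stable _ hR

variable {F} in
-- The pullback of `R` covers the middle term, and each of its members factors through the middle
-- term of an object of `R` by `exists_factor`.
lemma eq_of_overMap_comp_eq (hR : R ∈ aModTopology A M) {X : Over M} {N : SheafOfModules.{u} A}
    {t t' : overTotal F X ⟶ N} (h : ∀ (Y : Over M) (_ : R Y.hom) (φ : Y ⟶ X),
      overMap F φ ≫ t = overMap F φ ≫ t') : t = t' := by
  refine eq_of_comp_eq_of_mem (aModTopology A) (pullback_mem F hR X) fun W w hw => ?_
  obtain ⟨σ, hσ, -⟩ := exists_factor w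
  rw [← hσ, Category.assoc, Category.assoc, h (Over.mk _) hw]

variable {F G}

/-- A compatible family of maps between the middle terms over a covering sieve extends to the whole
slice. -/
lemma exists_extend_at (hR : R ∈ aModTopology A M)
    (a : ∀ Y : Over M, R Y.hom → (overTotal F Y ⟶ overTotal G Y))
    (ha : ∀ (Y Y' : Over M) (hY : R Y.hom) (hY' : R Y'.hom) (φ : Y' ⟶ Y),
      overMap F φ ≫ a Y hY = a Y' hY' ≫ overMap G φ) (X : Over M) :
    ∃ t : overTotal F X ⟶ overTotal G X, ∀ (Y : Over M) (hY : R Y.hom) (φ : Y ⟶ X),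
      overMap F φ ≫ t = a Y hY ≫ overMap G φ := by
  choose σ hσ hσ' using fun {W : SheafOfModules.{u} A} (t : W ⟶ overTotal F X) => exists_factor t
  -- The value on `w` is forced: lift `w` universally to the middle term over an object of `R`,
  -- apply `a` there and project. By `key` any other lift gives the same value.
  let gl {W : SheafOfModules.{u} A} (w : W ⟶ overTotal F X)
      (hw : R.pullback (overProj F X ≫ X.hom) w) : W ⟶ overTotal G X :=
    σ w ≫ a _ hw ≫ overMap G (Over.homMk (w ≫ overProj F X) (Category.assoc _ _ _))
  have key {W : SheafOfModules.{u} A} (w : W ⟶ overTotal F X)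
      (hw : R.pullback (overProj F X ≫ X.hom) w) {Y : Over M} (hY : R Y.hom) (φ : Y ⟶ X)
      (s : W ⟶ overTotal F Y) (hs : s ≫ overMap F φ = w) :
      s ≫ a Y hY ≫ overMap G φ = gl w hw := by
    obtain ⟨ψ, hψ, hψs⟩ := hσ' w φ s hs
    rw [← hψs, Category.assoc, ← Category.assoc (overMap F ψ), ha Y (Over.mk _) hY hw, Category.assoc,
      ← overMap_comp, hψ]
  obtain ⟨t, ht⟩ := exists_comp_eq_of_mem (aModTopology A) (pullback_mem F hR X)
    (fun W w hw => gl w hw) fun W V w hw v => by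
      refine Eq.trans ?_ (key (v ≫ w) _ (Y := Over.mk _) hw _ (v ≫ σ w)
        (by rw [Category.assoc, hσ w]))
      rw [Category.assoc]
  refine ⟨t, fun Y hY φ => ?_⟩
  have hφ : R.pullback (overProj F X ≫ X.hom) (overMap F φ) := by
    change R _
    rw [← Category.assoc, (isPullback_over F φ).w, Category.assoc, Over.w φ]
    exact R.downward_closed hY _
  rw [ht _ hφ, ← key _ hφ hY φ (𝟙 _) (Category.id_comp _), Category.id_comp]

lemma exists_hom_extend (hR : R ∈ aModTopology A M)
    (a : ∀ Y : Over M, R Y.hom → (overTotal F Y ⟶ overTotal G Y))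
    (ha : ∀ (Y Y' : Over M) (hY : R Y.hom) (hY' : R Y'.hom) (φ : Y' ⟶ Y),
      overMap F φ ≫ a Y hY = a Y' hY' ≫ overMap G φ)
    (ha_incl : ∀ Y hY, overIncl F Y ≫ a Y hY = overIncl G Y)
    (ha_proj : ∀ Y hY, a Y hY ≫ overProj G Y = overProj F Y) :
    ∃ α : F ⟶ G, ∀ (Y : Over M) (hY : R Y.hom), app (𝒵 := overFibered M) α Y = a Y hY := by
  choose t ht using exists_extend_at hR a ha
  obtain ⟨α, hα⟩ := exists_hom (𝒵 := overFibered M) (F := F) (G := G) t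
    (fun (X : Over M) => by
      refine eq_of_comp_eq_of_mem (aModTopology A)
        ((aModTopology A).pullback_stable (overIncl F X) (pullback_mem F hR X)) fun W w hw => ?_
      let Y := Over.mk ((w ≫ overIncl F X) ≫ overProj F X ≫ X.hom)
      let φ : Y ⟶ X := Over.homMk ((w ≫ overIncl F X) ≫ overProj F X) (Category.assoc _ _ _)
      have hY : R Y.hom := hw
      change w ≫ overIncl F X ≫ t X = w ≫ overIncl G X
      rw [← incl_overMap F φ, Category.assoc, ht X Y hY φ, ← Category.assoc (overIncl F Y), ha_incl,
        incl_overMap G φ])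
    (fun (X : Over M) => by
      change t X ≫ overProj G X = overProj F X
      refine eq_of_overMap_comp_eq hR fun Y hY φ => ?_
      rw [← Category.assoc, ht X Y hY φ, Category.assoc, (isPullback_over G φ).w,
        ← Category.assoc, ha_proj, (isPullback_over F φ).w])
    (fun (X X' : Over M) (χ : X ⟶ X') => by
      change overMap F χ ≫ t X' = t X ≫ overMap G χ
      refine eq_of_overMap_comp_eq hR fun Y hY φ => ?_
      rw [← Category.assoc, ← overMap_comp, ht _ Y hY, ← Category.assoc, ht _ Y hY, overMap_comp,
        Category.assoc])
  refine ⟨α, fun Y hY => (hα Y).trans ?_⟩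
  have := ht Y Y hY (𝟙 Y)
  rwa [overMap_id, overMap_id, Category.id_comp, Category.comp_id] at this

end ExtensionFamily

open ExtensionFamily

lemma faithful_restrictToSieve_extensionsOver {M : SheafOfModules.{u} A} {R : Sieve M}
    (hR : R ∈ aModTopology A M) : (restrictToSieve (extensionsOver K) R).Faithful where
  map_injective {F G} α β h := by
    refine InducedCategory.Hom.ext (ExtensionFamily.hom_ext fun X => ?_)
    refine eq_of_overMap_comp_eq hR fun Y hY φ => ?_
    have h' : app (𝒵 := overFibered M) α.hom Y = app (𝒵 := overFibered M) β.hom Y :=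
      congrArg (fun γ => app (𝒵 := sieveFibered R) γ.hom ⟨Y, hY⟩) h
    refine (naturality (𝒵 := overFibered M) α.hom φ).trans ?_
    rw [h']
    exact (naturality (𝒵 := overFibered M) β.hom φ).symm

lemma full_restrictToSieve_extensionsOver {M : SheafOfModules.{u} A} {R : Sieve M}
    (hR : R ∈ aModTopology A M) : (restrictToSieve (extensionsOver K) R).Full where
  map_surjective {F G} α := by
    obtain ⟨β, hβ⟩ := exists_hom_extend (F := F.obj) (G := G.obj) hR
      (fun Y hY => app (𝒵 := sieveFibered R) α.hom ⟨Y, hY⟩)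
      (fun Y Y' hY hY' φ => naturality (𝒵 := sieveFibered R) α.hom
        (X := ⟨Y', hY'⟩) (Y := ⟨Y, hY⟩) ⟨φ⟩)
      (fun Y hY => incl_app (𝒵 := sieveFibered R) α.hom ⟨Y, hY⟩)
      (fun Y hY => app_proj (𝒵 := sieveFibered R) α.hom ⟨Y, hY⟩)
    exact ⟨⟨β⟩, InducedCategory.Hom.ext (ExtensionFamily.hom_ext fun Y => hβ Y.obj Y.property)⟩

end SliceFamily

/-! ### Families on a sieve and their compatible sections -/

section SieveFamily

variable {C : Type u} [SmallCategory C] {J : GrothendieckTopology C} {A : Sheaf J RingCat.{u}}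
  {K : SheafOfModules.{u} A}

namespace ExtensionFamily

variable {M : SheafOfModules.{u} A} {R : Sieve M}
  (D : BasedFunctor (sieveFibered R) (extensionsOver K))

section

variable {Z W V : SheafOfModules.{u} A} {y : Z ⟶ M} (hy : R y) {y' : W ⟶ M} (hy' : R y')
  {y'' : V ⟶ M} (hy'' : R y'')

/-- The middle term, for a family of extensions on a sieve. -/
def sieveTotal {Z : SheafOfModules.{u} A} {y : Z ⟶ M} (hy : R y) : SheafOfModules.{u} A :=
  total (𝒵 := sieveFibered R) D ⟨Over.mk y, hy⟩

/-- The inclusion of `K` in the middle term, for a family of extensions on a sieve. -/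
def sieveIncl : K ⟶ sieveTotal D hy := incl (𝒵 := sieveFibered R) D ⟨Over.mk y, hy⟩

/-- The projection of the middle term, for a family of extensions on a sieve. -/
def sieveProj : sieveTotal D hy ⟶ Z := proj (𝒵 := sieveFibered R) D ⟨Over.mk y, hy⟩

/-- The map of middle terms, for a family of extensions on a sieve. -/
def sieveMap (w : W ⟶ Z) (h : w ≫ y = y') : sieveTotal D hy' ⟶ sieveTotal D hy :=
  map (𝒵 := sieveFibered R) D (X := ⟨Over.mk y', hy'⟩) (Y := ⟨Over.mk y, hy⟩) ⟨Over.homMk w h⟩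

lemma isPullback_sieve (w : W ⟶ Z) (h : w ≫ y = y') :
    IsPullback (sieveMap D hy hy' w h) (sieveProj D hy') (sieveProj D hy) w :=
  isPullback (𝒵 := sieveFibered R) D (X := ⟨Over.mk y', hy'⟩) (Y := ⟨Over.mk y, hy⟩)
    ⟨Over.homMk w h⟩

lemma sieveMap_comp (w : W ⟶ Z) (h : w ≫ y = y') (v : V ⟶ W) (h' : v ≫ y' = y'') (f : V ⟶ Z)
    (hf : f ≫ y = y'') (e : v ≫ w = f) :
    sieveMap D hy' hy'' v h' ≫ sieveMap D hy hy' w h = sieveMap D hy hy'' f hf := by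
  subst e
  exact (map_comp (𝒵 := sieveFibered R) D (X := ⟨Over.mk y'', hy''⟩) (Y := ⟨Over.mk y', hy'⟩)
    (Z := ⟨Over.mk y, hy⟩) ⟨Over.homMk v h'⟩ ⟨Over.homMk w h⟩).symm

lemma sieveMap_id (h : 𝟙 Z ≫ y = y) : sieveMap D hy hy (𝟙 Z) h = 𝟙 _ :=
  map_id (𝒵 := sieveFibered R) D ⟨Over.mk y, hy⟩

@[simp]
lemma sieveIncl_map (w : W ⟶ Z) (h : w ≫ y = y') :
    sieveIncl D hy' ≫ sieveMap D hy hy' w h = sieveIncl D hy :=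
  incl_map (𝒵 := sieveFibered R) D (X := ⟨Over.mk y', hy'⟩) (Y := ⟨Over.mk y, hy⟩)
    ⟨Over.homMk w h⟩

@[simp]
lemma sieveIncl_proj : sieveIncl D hy ≫ sieveProj D hy = 0 :=
  incl_proj (𝒵 := sieveFibered R) D ⟨Over.mk y, hy⟩

instance : Mono (sieveIncl D hy) :=
  inferInstanceAs (Mono (ext (𝒵 := sieveFibered R) D ⟨Over.mk y, hy⟩).incl)

instance : Epi (sieveProj D hy) :=
  epi_proj (𝒵 := sieveFibered R) D ⟨Over.mk y, hy⟩

lemma exists_sieveIncl_add {N : SheafOfModules.{u} A} (a b : N ⟶ sieveTotal D hy)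
    (h : a ≫ sieveProj D hy = b ≫ sieveProj D hy) : ∃ k : N ⟶ K, k ≫ sieveIncl D hy + a = b :=
  exists_lift (𝒵 := sieveFibered R) D ⟨Over.mk y, hy⟩ a b h

end

/-- A compatible family of sections of the extensions attached to the maps to `X`. -/
@[ext]
structure SieveSection {X : SheafOfModules.{u} A} (x : X ⟶ M) where
  /-- the section attached to a map `z : Z ⟶ X` -/
  val : ∀ {Z : SheafOfModules.{u} A} {y : Z ⟶ M} (hy : R y) (z : Z ⟶ X), z ≫ x = y →
    (Z ⟶ sieveTotal D hy)
  val_proj : ∀ {Z : SheafOfModules.{u} A} {y : Z ⟶ M} (hy : R y) (z : Z ⟶ X) (hz : z ≫ x = y),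
    val hy z hz ≫ sieveProj D hy = 𝟙 Z
  val_map : ∀ {Z W : SheafOfModules.{u} A} {y : Z ⟶ M} (hy : R y) (z : Z ⟶ X) (hz : z ≫ x = y)
    {y' : W ⟶ M} (hy' : R y') (w : W ⟶ Z) (hw : w ≫ y = y') (z' : W ⟶ X) (hz' : z' ≫ x = y')
    (_ : w ≫ z = z'), val hy' z' hz' ≫ sieveMap D hy hy' w hw = w ≫ val hy z hz

namespace SieveSection

variable {D} {X X' : SheafOfModules.{u} A} {x : X ⟶ M}

lemma val_congr (s : SieveSection D x) {Z : SheafOfModules.{u} A} {y : Z ⟶ M} (hy : R y)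
    {z z' : Z ⟶ X} (h : z = z') (hz : z ≫ x = y) (hz' : z' ≫ x = y) :
    s.val hy z hz = s.val hy z' hz' := by
  subst h
  rfl

/-- The restriction of a compatible family of sections. -/
def res {x' : X' ⟶ M} (f : X' ⟶ X) (h : f ≫ x = x') (s : SieveSection D x) :
    SieveSection D x' where
  val hy z hz := s.val hy (z ≫ f) (by rw [Category.assoc, h, hz])
  val_proj hy z hz := s.val_proj hy _ _
  val_map hy z hz _ hy' w hw z' hz' e :=
    s.val_map hy _ _ hy' w hw _ _ (by rw [← e, Category.assoc])

/-- The translate of a compatible family of sections. -/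
def act (k : X ⟶ K) (s : SieveSection D x) : SieveSection D x where
  val hy z hz := (z ≫ k) ≫ sieveIncl D hy + s.val hy z hz
  val_proj hy z hz := by
    rw [Preadditive.add_comp, Category.assoc, sieveIncl_proj, comp_zero, zero_add, s.val_proj]
  val_map hy z hz _ hy' w hw z' hz' e := by
    rw [Preadditive.add_comp, Preadditive.comp_add, Category.assoc, sieveIncl_map,
      s.val_map hy z hz hy' w hw z' hz' e, ← e]
    simp only [Category.assoc]

/-- Over each map whose composite to `M` is in `R`, the two sections of an extension differ by a
unique map to `K`; uniqueness makes these differences compatible, and they glue because `R` pulls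
back to a cover of `X`. -/
lemma existsUnique_act_eq (hR : R ∈ aModTopology A M) (s t : SieveSection D x) :
    ∃! k : X ⟶ K, s.act k = t := by
  have h₁ {Z : SheafOfModules.{u} A} (z : Z ⟶ X) (hz : R (z ≫ x)) :
      ∃ k : Z ⟶ K, k ≫ sieveIncl D (y := z ≫ x) hz + s.val hz z rfl = t.val hz z rfl :=
    exists_sieveIncl_add D _ _ _ (by rw [s.val_proj, t.val_proj])
  choose k hk using @h₁
  have hk' {Z : SheafOfModules.{u} A} {y : Z ⟶ M} (hy : R y) (z : Z ⟶ X) (hz : z ≫ x = y)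
      (hz' : R (z ≫ x)) :
      k z hz' ≫ sieveIncl D hy + s.val hy z hz = t.val hy z hz := by
    subst hz
    exact hk z hz'
  have hcover := (aModTopology A).pullback_stable x hR
  obtain ⟨l, hl⟩ := exists_comp_eq_of_mem (aModTopology A) hcover (fun Z z hz => k z hz)
    fun Z W z hz w => by
      have hz₀ : R (z ≫ x) := hz
      have hw : R (w ≫ z ≫ x) := R.downward_closed hz₀ w
      have hwz : R ((w ≫ z) ≫ x) := (R.pullback x).downward_closed hz w
      have e := hk' hw (w ≫ z) (Category.assoc _ _ _) hwz
      have e' := congrArg (· ≫ sieveMap D hz₀ hw w rfl) e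
      simp only [Preadditive.add_comp, Category.assoc, sieveIncl_map] at e'
      rw [s.val_map hz₀ z rfl hw w rfl _ _ rfl, t.val_map hz₀ z rfl hw w rfl _ _ rfl,
        ← hk' hz₀ z rfl hz, Preadditive.comp_add] at e'
      rw [← cancel_mono (sieveIncl D hz₀), Category.assoc]
      exact (add_right_cancel e').symm
  refine ⟨l, SieveSection.ext ?_, fun l' hl' => ?_⟩
  · funext Z y hy z hz
    subst hz
    change (z ≫ l) ≫ _ + _ = _
    rw [hl z hy, hk]
  · refine eq_of_comp_eq_of_mem (aModTopology A) hcover fun Z z hz => ?_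
    have hz₀ : R (z ≫ x) := hz
    rw [hl z hz, ← cancel_mono (sieveIncl D hz₀)]
    refine add_right_cancel (Eq.trans ?_ (hk z hz).symm)
    rw [← hl']
    rfl

end SieveSection

end ExtensionFamily

end SieveFamily

/-! ### The torsor of a descent datum -/

section Effectivity

variable {C : Type u} [SmallCategory C] {J : GrothendieckTopology C} {A : Sheaf J RingCat.{u}}
  {K : SheafOfModules.{u} A}

namespace ExtensionFamily

variable {M : SheafOfModules.{u} A} {R : Sieve M}
  {D : BasedFunctor (sieveFibered R) (extensionsOver K)}

namespace SieveSection

lemma exists_glue {X : SheafOfModules.{u} A} (x : X ⟶ M) (S : Sieve X) (hS : S ∈ aModTopology A X)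
    (s : ∀ ⦃Y : SheafOfModules.{u} A⦄ (f : Y ⟶ X), S f → SieveSection D (f ≫ x))
    (hs : ∀ ⦃Y Z : SheafOfModules.{u} A⦄ (f : Y ⟶ X) (hf : S f) (g : Z ⟶ Y),
      (s f hf).res g (Category.assoc _ _ _).symm = s (g ≫ f) (S.downward_closed hf g)) :
    ∃ t : SieveSection D x, ∀ ⦃Y : SheafOfModules.{u} A⦄ (f : Y ⟶ X) (hf : S f),
      t.res f rfl = s f hf := by
  have H {Y V Z : SheafOfModules.{u} A} (f : Y ⟶ X) (hf : S f) (v : V ⟶ Y) (f' : V ⟶ X)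
      (hf' : S f') (e : v ≫ f = f') {y : Z ⟶ M} (hy : R y) (z : Z ⟶ V) (hz : z ≫ f' ≫ x = y)
      (z' : Z ⟶ Y) (hz' : z' ≫ f ≫ x = y) (e' : z ≫ v = z') :
      (s f' hf').val hy z hz = (s f hf).val hy z' hz' := by
    subst e e'
    rw [← hs f hf v]
    rfl
  -- The value at `z` is glued over the pullback of `S` along `z`. It is characterised through every
  -- factorisation over a member of `S`, which makes the later compatibilities formal.
  have glue {Z : SheafOfModules.{u} A} {y : Z ⟶ M} (hy : R y) (z : Z ⟶ X) (hz : z ≫ x = y) :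
      ∃ a : Z ⟶ sieveTotal D hy, ∀ {W Y : SheafOfModules.{u} A} (w : W ⟶ Z) {y' : W ⟶ M}
        (hy' : R y') (h : w ≫ y = y') (f : Y ⟶ X) (hf : S f) (v : W ⟶ Y)
        (hv : v ≫ f ≫ x = y') (_ : v ≫ f = w ≫ z),
        w ≫ a = (s f hf).val hy' v hv ≫ sieveMap D hy hy' w h := by
    obtain ⟨a, ha⟩ := exists_comp_eq_of_mem (aModTopology A)
      ((aModTopology A).pullback_stable z hS)
      (fun W w hw => (s (w ≫ z) hw).val (R.downward_closed hy w) (𝟙 W)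
        (by rw [Category.id_comp, Category.assoc, hz]) ≫
          sieveMap D hy (R.downward_closed hy w) w rfl) fun W V w hw v => by
        have hw' : S (w ≫ z) := hw
        have hvw : S ((v ≫ w) ≫ z) := (S.pullback z).downward_closed hw v
        have hyv : R ((v ≫ w) ≫ y) := R.downward_closed hy (v ≫ w)
        have e : v ≫ (w ≫ z) ≫ x = (v ≫ w) ≫ y := by simp only [Category.assoc, hz]
        rw [H (w ≫ z) hw' v ((v ≫ w) ≫ z) hvw (Category.assoc _ _ _).symm hyv (𝟙 V) _ v e
          (Category.id_comp v), ← sieveMap_comp D hy (R.downward_closed hy w) hyv w rfl v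
            (Category.assoc _ _ _).symm (v ≫ w) rfl rfl]
        refine (Category.assoc _ _ _).symm.trans (Eq.trans ?_ (Category.assoc _ _ _))
        refine congrArg (· ≫ sieveMap D hy (R.downward_closed hy w) w rfl) ?_
        exact ((s (w ≫ z) hw').val_map _ _ _ hyv v _ v e (Category.comp_id v)).symm
    refine ⟨a, fun {W Y} w {y'} hy' h f hf v hv e => ?_⟩
    subst h
    have hw : S (w ≫ z) := by
      rw [← e]
      exact S.downward_closed hf v
    rw [ha w hw, H f hf v (w ≫ z) hw e hy' (𝟙 W) _ v hv (Category.id_comp v)]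
  choose a ha using @glue
  refine ⟨{ val := fun {Z y} hy z hz => a hy z hz, val_proj := ?_, val_map := ?_ }, ?_⟩
  · intro Z y hy z hz
    refine eq_of_comp_eq_of_mem (aModTopology A) ((aModTopology A).pullback_stable z hS)
      fun W w hw => ?_
    rw [← Category.assoc, ha hy z hz w (R.downward_closed hy w) rfl (w ≫ z) hw (𝟙 W)
      (by simp [hz]) (Category.id_comp _), Category.assoc, (isPullback_sieve D hy _ w rfl).w,
      ← Category.assoc, val_proj, Category.id_comp, Category.comp_id]
  · intro Z W y hy z hz y' hy' w hw z' hz' e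
    refine eq_of_comp_eq_of_mem (aModTopology A) ((aModTopology A).pullback_stable z' hS)
      fun V v hv => ?_
    have hyv : R (v ≫ y') := R.downward_closed hy' v
    rw [← Category.assoc, ha hy' z' hz' v hyv rfl (v ≫ z') hv (𝟙 V) (by simp [hz'])
      (Category.id_comp _)]
    refine (Category.assoc _ _ _).trans (Eq.trans ?_ (Category.assoc _ _ _))
    rw [sieveMap_comp D hy hy' hyv w hw v rfl (v ≫ w) (by rw [Category.assoc, hw]) rfl]
    exact (ha hy z hz (v ≫ w) hyv (by rw [Category.assoc, hw]) (v ≫ z') hv (𝟙 V) (by simp [hz'])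
      (by rw [Category.id_comp, Category.assoc, e])).symm
  · intro Y f hf
    refine SieveSection.ext ?_
    funext Z y hy z hz
    have := ha hy (z ≫ f) (by rw [Category.assoc, hz]) (𝟙 Z) hy (Category.id_comp _) f hf z hz
      (Category.id_comp _).symm
    rw [sieveMap_id, Category.comp_id, Category.id_comp] at this
    exact this

/-- A lift `q` of `x` to a middle term of the family induces, through the pullback squares, a
section of every extension lying over `X`. -/
lemma exists_of_factors {X : SheafOfModules.{u} A} {Y : SheafOfModules.{u} A} {y : Y ⟶ M}
    (hy : R y) (q : X ⟶ sieveTotal D hy) (x : X ⟶ M) (hx : q ≫ sieveProj D hy ≫ y = x) :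
    Nonempty (SieveSection D x) := by
  have hP {Z : SheafOfModules.{u} A} {y' : Z ⟶ M} (hy' : R y') (z : Z ⟶ X) (hz : z ≫ x = y') :=
    isPullback_sieve D hy hy' (z ≫ q ≫ sieveProj D hy) (by simp only [Category.assoc, hx, hz])
  have hw {Z : SheafOfModules.{u} A} (z : Z ⟶ X) :
      (z ≫ q) ≫ sieveProj D hy = 𝟙 Z ≫ z ≫ q ≫ sieveProj D hy := by
    rw [Category.id_comp, Category.assoc]
  refine ⟨⟨fun hy' z hz => (hP hy' z hz).lift (z ≫ q) (𝟙 _) (hw z),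
    fun hy' z hz => IsPullback.lift_snd _ _ _ _, ?_⟩⟩
  intro Z W y₁ hy₁ z hz y₂ hy₂ w hw' z' hz' e
  subst e
  refine (hP hy₁ z hz).hom_ext ?_ ?_
  · rw [Category.assoc, sieveMap_comp D hy hy₁ hy₂ _ _ _ _ ((w ≫ z) ≫ q ≫ sieveProj D hy) _
      (Category.assoc _ _ _).symm]
    refine ((hP hy₂ (w ≫ z) hz').lift_fst _ _ (hw (w ≫ z))).trans ?_
    rw [Category.assoc, Category.assoc]
    exact congrArg (w ≫ ·) ((hP hy₁ z hz).lift_fst _ _ (hw z)).symm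
  · rw [Category.assoc, (isPullback_sieve D hy₁ hy₂ w hw').w, ← Category.assoc,
      IsPullback.lift_snd, Category.assoc, IsPullback.lift_snd, Category.comp_id, Category.id_comp]

end SieveSection

/-- The torsor of sections of a family of extensions on a covering sieve. -/
def sieveTorsor (hR : R ∈ aModTopology A M)
    (D : BasedFunctor (sieveFibered R) (extensionsOver K)) :
    TorsorOver.{u, u + 1, u + 1} (aModTopology A) M K where
  -- A compatible family ranges over all modules, so sections live in `Type (u + 1)`; hence the free
  -- universe in `TorsorOver`.
  sec x := SieveSection D x
  res f h s := s.res f h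
  res_id h s := SieveSection.ext (by
    funext Z y hy z hz
    exact s.val_congr hy (Category.comp_id z) _ _)
  res_res f hf g hg s := SieveSection.ext (by
    funext Z y hy z hz
    exact s.val_congr hy (Category.assoc _ _ _) _ _)
  act k s := s.act k
  zero_act s := SieveSection.ext (by
    funext Z y hy z hz
    change (z ≫ 0) ≫ _ + _ = _
    simp)
  add_act k l s := SieveSection.ext (by
    funext Z y hy z hz
    change (z ≫ (k + l)) ≫ _ + _ = (z ≫ k) ≫ _ + ((z ≫ l) ≫ _ + _)
    rw [Preadditive.comp_add, Preadditive.add_comp, add_assoc])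
  res_act f hf k s := SieveSection.ext (by
    funext Z y hy z hz
    change ((z ≫ f) ≫ k) ≫ _ + _ = (z ≫ f ≫ k) ≫ _ + _
    rw [Category.assoc]
    rfl)
  free_transitive s t := SieveSection.existsUnique_act_eq hR s t
  exists_glue x S hS s hs := SieveSection.exists_glue x S hS s hs
  locally_nonempty := by
    -- The maps to `M` that lift to a middle term of the family form a covering sieve, because `R`
    -- is covering and the projections of the middle terms are epi.
    let S : Sieve M :=
      { arrows := fun X x => ∃ (Y : SheafOfModules.{u} A) (y : Y ⟶ M) (hy : R y)
          (q : X ⟶ sieveTotal D hy), q ≫ sieveProj D hy ≫ y = x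
        downward_closed := by
          rintro X X' x ⟨Y, y, hy, q, hq⟩ g
          exact ⟨Y, y, hy, g ≫ q, by rw [Category.assoc, hq]⟩ }
    refine ⟨S, (aModTopology A).transitive hR S fun Y y hy => ?_,
      fun X x ⟨Y, y, hy, q, hq⟩ => SieveSection.exists_of_factors hy q x hq⟩
    refine (aModTopology A).superset_covering ?_
      (aModTopology_generateSingleton_mem (sieveProj D hy))
    rintro X _ ⟨q, rfl⟩
    exact ⟨Y, y, hy, q, (Category.assoc _ _ _).symm⟩

end ExtensionFamily

end Effectivity

/-! ### Effectivity of descent, the stack and the gerbe -/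

section Stack

variable {C : Type u} [SmallCategory C] {J : GrothendieckTopology C} {A : Sheaf J RingCat.{u}}
  {K : SheafOfModules.{u} A}

namespace Extension

variable (ξ : Extension K)

/-- The map of base changes attached to an arrow over the base of an extension. -/
noncomputable def pullbackMap {X Y : Over ξ.base} (φ : X ⟶ Y) :
    pullback ξ.proj X.hom ⟶ pullback ξ.proj Y.hom :=
  pullback.lift (pullback.fst ξ.proj X.hom) (pullback.snd ξ.proj X.hom ≫ φ.left)
    (by rw [Category.assoc, Over.w φ, pullback.condition])

@[simp]
lemma pullbackMap_fst {X Y : Over ξ.base} (φ : X ⟶ Y) :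
    ξ.pullbackMap φ ≫ pullback.fst ξ.proj Y.hom = pullback.fst ξ.proj X.hom :=
  pullback.lift_fst _ _ _

@[simp]
lemma pullbackMap_snd {X Y : Over ξ.base} (φ : X ⟶ Y) :
    ξ.pullbackMap φ ≫ pullback.snd ξ.proj Y.hom = pullback.snd ξ.proj X.hom ≫ φ.left :=
  pullback.lift_snd _ _ _

lemma pullbackMap_id (X : Over ξ.base) : ξ.pullbackMap (𝟙 X) = 𝟙 _ :=
  pullback.hom_ext (by simp) (by simp)

lemma pullbackMap_comp {X Y Z : Over ξ.base} (φ : X ⟶ Y) (ψ : Y ⟶ Z) :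
    ξ.pullbackMap (φ ≫ ψ) = ξ.pullbackMap φ ≫ ξ.pullbackMap ψ :=
  pullback.hom_ext (by simp) (by
    rw [Category.assoc, pullbackMap_snd, pullbackMap_snd, ← Category.assoc, pullbackMap_snd,
      Category.assoc, Over.comp_left])

/-- The inclusion of `K` in a base change. -/
noncomputable def pullbackIncl (X : Over ξ.base) : K ⟶ pullback ξ.proj X.hom :=
  pullback.lift ξ.incl 0 (by rw [ξ.w, zero_comp])

@[simp]
lemma pullbackIncl_fst (X : Over ξ.base) :
    ξ.pullbackIncl X ≫ pullback.fst ξ.proj X.hom = ξ.incl :=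
  pullback.lift_fst _ _ _

@[simp]
lemma pullbackIncl_snd (X : Over ξ.base) : ξ.pullbackIncl X ≫ pullback.snd ξ.proj X.hom = 0 :=
  pullback.lift_snd _ _ _

lemma pullbackIncl_map {X Y : Over ξ.base} (φ : X ⟶ Y) :
    ξ.pullbackIncl X ≫ ξ.pullbackMap φ = ξ.pullbackIncl Y := by
  refine pullback.hom_ext (by simp) ?_
  rw [Category.assoc, pullbackMap_snd, ← Category.assoc, pullbackIncl_snd, pullbackIncl_snd,
    zero_comp]

/-- The family of base changes of an extension, on the slice over its base. -/
noncomputable def baseChangeFamily : BasedFunctor (overFibered ξ.base) (extensionsOver K) where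
  obj (X : Over ξ.base) := ξ.baseChange X.hom
  map {X Y : Over ξ.base} (φ : X ⟶ Y) :=
    ({ base := φ.left
       total := ξ.pullbackMap φ
       incl_total := ξ.pullbackIncl_map φ
       total_proj := ξ.pullbackMap_snd φ } :
      Extension.Hom (ξ.baseChange X.hom) (ξ.baseChange Y.hom))
  map_id (X : Over ξ.base) := Extension.Hom.ext rfl (ξ.pullbackMap_id X)
  map_comp {X Y Z : Over ξ.base} (φ : X ⟶ Y) (ψ : Y ⟶ Z) :=
    Extension.Hom.ext rfl (ξ.pullbackMap_comp φ ψ)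
  w := rfl

end Extension

namespace ExtensionFamily

namespace SieveSection

variable {ξ : Extension K} {R : Sieve ξ.base}
  {D : BasedFunctor (sieveFibered R) (extensionsOver K)} (s : SieveSection D ξ.proj)

/-- The map from a base change given by a section over the middle term. -/
noncomputable def desc (X : Over ξ.base) (hX : R X.hom) :
    pullback ξ.proj X.hom ⟶ sieveTotal D hX :=
  s.val (R.downward_closed hX (pullback.snd ξ.proj X.hom)) (pullback.fst ξ.proj X.hom)
    pullback.condition ≫ sieveMap D hX _ (pullback.snd ξ.proj X.hom) rfl

lemma desc_proj (X : Over ξ.base) (hX : R X.hom) :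
    s.desc X hX ≫ sieveProj D hX = pullback.snd ξ.proj X.hom := by
  rw [desc, Category.assoc, (isPullback_sieve D hX _ _ rfl).w, ← Category.assoc, s.val_proj,
    Category.id_comp]

/-- The map from a base change, precomposed with a map to the base change. -/
lemma comp_desc (X : Over ξ.base) (hX : R X.hom) {Z : SheafOfModules.{u} A}
    (f : Z ⟶ pullback ξ.proj X.hom) {y : Z ⟶ ξ.base} (hy : R y) (a : Z ⟶ ξ.total)
    (ha : a ≫ ξ.proj = y) (b : Z ⟶ X.left) (hb : b ≫ X.hom = y)
    (hfa : f ≫ pullback.fst ξ.proj X.hom = a) (hfb : f ≫ pullback.snd ξ.proj X.hom = b) :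
    f ≫ s.desc X hX = s.val hy a ha ≫ sieveMap D hX hy b hb := by
  have hf : f ≫ pullback.snd ξ.proj X.hom ≫ X.hom = y := by rw [← Category.assoc, hfb, hb]
  rw [desc, ← Category.assoc, ← s.val_map _ _ _ hy f hf a ha hfa, Category.assoc,
    sieveMap_comp D _ _ _ _ _ _ _ b hb hfb]

lemma pullbackMap_desc {X Y : Over ξ.base} (φ : X ⟶ Y) (hX : R X.hom) (hY : R Y.hom) :
    ξ.pullbackMap φ ≫ s.desc Y hY = s.desc X hX ≫ sieveMap D hY hX φ.left (Over.w φ) := by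
  have hX' : R (pullback.snd ξ.proj X.hom ≫ X.hom) := R.downward_closed hX _
  rw [s.comp_desc Y hY (ξ.pullbackMap φ) hX' _ pullback.condition
    (pullback.snd ξ.proj X.hom ≫ φ.left) (by rw [Category.assoc, Over.w φ])
    (ξ.pullbackMap_fst φ) (ξ.pullbackMap_snd φ), desc]
  refine Eq.trans ?_ (Category.assoc _ _ _).symm
  rw [sieveMap_comp D hY hX hX' _ _ _ _ (pullback.snd ξ.proj X.hom ≫ φ.left)
      (by rw [Category.assoc, Over.w φ]) rfl]

/-- The normalisation `hs`, evaluated over the zero map `K → M`, says that `s` at `ξ.incl` is the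
inclusion plus `s` at zero. The latter dies in the extension over `X`, as its image factors through
a zero map. -/
lemma pullbackIncl_desc
    (hs : s.res ξ.incl ξ.w = SieveSection.act (𝟙 K) (s.res (0 : K ⟶ ξ.total) zero_comp))
    (X : Over ξ.base) (hX : R X.hom) : ξ.pullbackIncl X ≫ s.desc X hX = sieveIncl D hX := by
  have h₀ : R (0 : K ⟶ ξ.base) := by
    have := R.downward_closed hX (0 : K ⟶ X.left)
    rwa [zero_comp] at this
  rw [s.comp_desc X hX (ξ.pullbackIncl X) h₀ _ ξ.w 0 zero_comp (ξ.pullbackIncl_fst X)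
    (ξ.pullbackIncl_snd X)]
  have e := congrArg (fun t => t.val h₀ (𝟙 K) (Category.id_comp _)) hs
  have e₁ : s.val h₀ ξ.incl ξ.w = sieveIncl D h₀ + s.val h₀ 0 zero_comp := by
    rw [s.val_congr h₀ (Category.id_comp ξ.incl).symm _ (by rw [Category.id_comp, ξ.w]),
      s.val_congr h₀ (comp_zero (f := 𝟙 K)).symm _ (by rw [comp_zero, zero_comp])]
    refine e.trans ?_
    change (𝟙 K ≫ 𝟙 K) ≫ _ + _ = _
    rw [Category.id_comp, Category.id_comp]
    rfl
  have e₂ : s.val h₀ 0 zero_comp ≫ sieveMap D hX h₀ 0 zero_comp = 0 := by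
    rw [← sieveMap_comp D hX h₀ h₀ 0 zero_comp 0 zero_comp 0 zero_comp zero_comp,
      ← Category.assoc, s.val_map h₀ 0 zero_comp h₀ 0 zero_comp 0 zero_comp zero_comp, zero_comp,
      zero_comp]
  rw [e₁, Preadditive.add_comp, e₂, add_zero, sieveIncl_map]

end SieveSection

lemma exists_hom_baseChangeFamily (ξ : Extension K) {R : Sieve ξ.base}
    {D : BasedFunctor (sieveFibered R) (extensionsOver K)} (s : SieveSection D ξ.proj)
    (hs : s.res ξ.incl ξ.w = SieveSection.act (𝟙 K) (s.res (0 : K ⟶ ξ.total) zero_comp)) :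
    Nonempty ((sieveFiberedInclusion R).comp ξ.baseChangeFamily ⟶ D) := by
  obtain ⟨α, -⟩ := exists_hom (𝒵 := sieveFibered R)
    (F := (sieveFiberedInclusion R).comp ξ.baseChangeFamily) (G := D)
    (fun X => s.desc X.obj X.property) (fun X => s.pullbackIncl_desc hs X.obj X.property)
    (fun X => (s.desc_proj X.obj X.property).trans (Category.comp_id _).symm)
    (fun X Y φ => s.pullbackMap_desc φ.hom X.property Y.property)
  exact ⟨α⟩

end ExtensionFamily

open ExtensionFamily

/-- The torsor of compatible sections of `D` is represented by an extension of `M`. Its universal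
section gives a morphism from the base changes of this extension to `D`, and morphisms of families
are isomorphisms. -/
lemma essSurj_restrictToSieve_extensionsOver {M : SheafOfModules.{u} A} {R : Sieve M}
    (hR : R ∈ aModTopology A M) : (restrictToSieve (extensionsOver K) R).EssSurj where
  mem_essImage D := by
    obtain ⟨E, i, p, w, u, hE, hu⟩ :=
      (sieveTorsor hR D.obj).exists_extension (isFinitelyLifting_aModTopology A)
    let ξ : Extension K := ⟨M, E, i, p, w, hE⟩
    have hs : SieveSection.res (D := D.obj) i w u =
        SieveSection.act (𝟙 K) (SieveSection.res (0 : K ⟶ E) zero_comp u) := by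
      have := TorsorOver.res_incl_add hu (𝟙 K) (0 : K ⟶ E) (by simp [w]) zero_comp
      refine Eq.trans ?_ this
      exact (sieveTorsor hR D.obj).res_congr (by simp) w u
    obtain ⟨α⟩ := exists_hom_baseChangeFamily ξ (R := R) (D := D.obj) u hs
    have := isIso_hom α
    exact ⟨⟨ξ.baseChangeFamily, sendsToCartesian _⟩, ⟨ObjectProperty.isoMk _ (@asIso _ _ _ _ α this)⟩⟩

lemma isStackOver_extensionsOver (K : SheafOfModules.{u} A) :
    IsStackOver (aModTopology A) (extensionsOver K) where
  isFibered := isFibered_extensionsOver K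
  descent _ _ hR :=
    { faithful := faithful_restrictToSieve_extensionsOver hR
      full := full_restrictToSieve_extensionsOver hR
      essSurj := essSurj_restrictToSieve_extensionsOver hR }

lemma exists_extension_base (K N : SheafOfModules.{u} A) : ∃ ξ : Extension K, ξ.base = N :=
  ⟨{ base := N
     total := K ⊞ N
     incl := biprod.inl
     proj := biprod.snd
     w := biprod.inl_snd
     exact := (ShortComplex.Splitting.ofHasBinaryBiproduct K N).shortExact }, rfl⟩

/-- A lift of a map to the middle term splits the pulled-back extension, so the split extension `K ⊞
N` maps to both. -/
lemma Extension.exists_span (ξ η : Extension K) {N : SheafOfModules.{u} A} (a : N ⟶ ξ.total)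
    (b : N ⟶ η.total) : ∃ (ζ : Extension K) (φ : ζ ⟶ ξ) (ψ : ζ ⟶ η) (h : ζ.base = N),
      Hom.base φ = eqToHom h ≫ a ≫ ξ.proj ∧ Hom.base ψ = eqToHom h ≫ b ≫ η.proj := by
  let ζ : Extension K :=
    { base := N
      total := K ⊞ N
      incl := biprod.inl
      proj := biprod.snd
      w := biprod.inl_snd
      exact := (ShortComplex.Splitting.ofHasBinaryBiproduct K N).shortExact }
  let m (θ : Extension K) (c : N ⟶ θ.total) : ζ ⟶ θ :=
    ({ base := c ≫ θ.proj
       total := biprod.desc θ.incl c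
       incl_total := biprod.inl_desc _ _
       total_proj := by
         refine biprod.hom_ext' _ _ ?_ ?_ <;> simp [ζ, θ.w] } : Extension.Hom ζ θ)
  exact ⟨ζ, m ξ a, m η b, rfl, (Category.id_comp _).symm, (Category.id_comp _).symm⟩

lemma Extension.isHomLift_of_comp_eqToHom {ξ η : Extension K} (φ : ξ ⟶ η)
    {N : SheafOfModules.{u} A} (h : η.base = N) (f : ξ.base ⟶ N)
    (e : Hom.base φ ≫ eqToHom h = f) : (extensionsOver K).p.IsHomLift f φ := by
  subst h
  exact (isHomLift_iff _ _).2 ((Category.comp_id _).symm.trans e)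

/-- Split extensions give objects everywhere. Two extensions of `M` are locally isomorphic on the
intersection of the sieves generated by their projections, where both become split. -/
lemma isGerbeOver_extensionsOver (K : SheafOfModules.{u} A) :
    IsGerbeOver (aModTopology A) (extensionsOver K) where
  toIsStackOver := isStackOver_extensionsOver K
  isCartesian _ _ φ := Extension.isStronglyCartesian φ
  locally_nonempty M := ⟨⊤, (aModTopology A).top_mem M, fun N _ _ => exists_extension_base K N⟩
  locally_connected M (x y : Extension K) hx hy := by
    have key (x y : Extension K) (h : y.base = x.base) : ∃ R ∈ aModTopology A x.base,
        ∀ ⦃N : SheafOfModules.{u} A⦄ (f : N ⟶ x.base), R f →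
          ∃ (z : Extension K) (φ : z ⟶ x) (ψ : z ⟶ y),
            (extensionsOver K).p.IsHomLift f φ ∧ (extensionsOver K).p.IsHomLift f ψ := by
      refine ⟨Sieve.generateSingleton x.proj ⊓ Sieve.generateSingleton (y.proj ≫ eqToHom h),
        (aModTopology A).intersection_covering (aModTopology_generateSingleton_mem _)
          (aModTopology_generateSingleton_mem _), ?_⟩
      rintro N f ⟨⟨a, ha⟩, ⟨b, hb⟩⟩
      obtain ⟨z, φ, ψ, rfl, hφ, hψ⟩ := x.exists_span y a b
      exact ⟨z, φ, ψ, Extension.isHomLift_of_comp_eqToHom φ rfl f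
          ((Category.comp_id _).trans (hφ.trans ((Category.id_comp _).trans ha))),
        Extension.isHomLift_of_comp_eqToHom ψ h f
          ((congrArg (· ≫ eqToHom h) (hψ.trans (Category.id_comp _))).trans
            ((Category.assoc _ _ _).trans hb))⟩
    subst hx
    exact key x y hy

end Stack

theorem mainTheorem1 {C : Type u} [SmallCategory C] (J : GrothendieckTopology C)
    (A : Sheaf J RingCat.{u}) (K : SheafOfModules.{u} A) :
    ∃ h : ∀ ξ : Extension K, ξ.toActedPresheaf.IsTorsor,
      (extensionsOver K).p.IsFibered ∧
      (torsorsOver K).p.IsFibered ∧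
      IsEquivalenceOver (rho K h) ∧
      IsStackOver (aModTopology A) (extensionsOver K) ∧
      IsGerbeOver (aModTopology A) (extensionsOver K) :=
  ⟨Extension.isTorsor, isFibered_extensionsOver K, isFibered_torsorsOver Extension.isTorsor,
    isEquivalenceOver_rho Extension.isTorsor, isStackOver_extensionsOver K,
    isGerbeOver_extensionsOver K⟩
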